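/- **Corollary (cactus graphs are tractable with an oracle).** Let $G=(V,E)$ be a finite connected simple graph with a root $r\in V$ and two weight functions $\gamma,\tau:E\to\mathbb{R}$ (cable and trench costs). The generalized cable-trench cost of a spanning tree $T$ of $G$ is $$\mathrm{cost}(T)=\sum_{e\in E(T)}\tau(e)+\sum_{w\in V}\ \sum_{e\in P_T(r,w)}\gamma(e),$$ where $P_T(r,w)$ is the path from $r$ to $w$ in $T$; a cable-trench tree of $G$ is a spanning tree of $G$ of minimum cost. The graph $G$ is a cactus graph if each of its edges lies in at most one cycle. Suppose that for each cactus graph $G$ an oracle supplies a decomposition of $G$ into cycles and trees, that is, subgraphs $G_1,\dots,G_c$ of $G$, each of which is a cycle or a tree, such that the edge sets $E(G_1),\dots,E(G_c)$ form a partition of $E$ and any two distinct $G_i,G_j$ have at most one vertex in common. Then a cable-trench tree of a cactus graph can be computed in polynomial time. Precisely: there are one program for a random access machine, whose elementary steps are addition, subtraction, comparison, and direct or indirect access to a memory cell, each operating on natural numbers or on real weights, and a polynomial $p$, such that for every cactus graph $G$ with $n$ vertices, every root $r$, all weights $\gamma,\tau:E\to\mathbb{R}$, and every such decomposition of $G$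 that the oracle may supply, the program, given $G$, $r$, $\gamma$, $\tau$ and the decomposition as input, halts after at most $p(n)$ steps and outputs a cable-trench tree of $G$ with root $r$. -/

import Mathlib

namespace CableTrench

/-! ### The generalized cable-trench problem -/

section Problem

variable {V : Type*}

/-- The `γ`-length of the unique path from `u` to `v` in the tree `T`. -/
noncomputable def cableLength {T : SimpleGraph V} (hT : T.IsTree) (γ : Sym2 V → ℝ) (u v : V) : ℝ :=
  ((hT.existsUnique_path u v).choose.edges.map γ).sum

/-- Generalized cable-trench cost of a spanning tree `T` rooted at `r`: the total trench cost of the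
edges of `T`, plus the cable lengths of the paths in `T` from the root to all the vertices.
Only the values of `γ` and `τ` on edges of `T` matter. -/
noncomputable def cost [Fintype V] {T : SimpleGraph V} (hT : T.IsTree) (γ τ : Sym2 V → ℝ) (r : V) :
    ℝ :=
  (∑ᶠ e ∈ T.edgeSet, τ e) + ∑ w : V, cableLength hT γ r w

/-- `T` is a cable-trench tree (cable-trench solution) of `G` with root `r`: a spanning tree of `G`
whose cost is minimal among all spanning trees of `G`. -/
def IsCableTrenchTree [Fintype V] (G : SimpleGraph V) (γ τ : Sym2 V → ℝ) (r : V)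
    (T : SimpleGraph V) : Prop :=
  ∃ hT : T.IsTree, T ≤ G ∧ ∀ (S : SimpleGraph V) (hS : S.IsTree), S ≤ G →
    cost hT γ τ r ≤ cost hS γ τ r

/-- A cactus graph: a connected graph in which every edge lies in at most one cycle, that is, two
cycles with a common edge have the same edges. -/
def IsCactus (G : SimpleGraph V) : Prop :=
  G.Connected ∧
    ∀ (u v : V) (p : G.Walk u u) (q : G.Walk v v), p.IsCycle → q.IsCycle →
      (∃ e, e ∈ p.edges ∧ e ∈ q.edges) → ∀ f, f ∈ p.edges ↔ f ∈ q.edges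

/-- A decomposition of `G` into `c` cycles and trees, any two of which meet in at most one vertex.
The edge sets of the parts form a partition of the edge set of `G`. No further maximality of the
parts is required, so this comprises every more restrictive kind of such decompositions. -/
structure Decomposition (G : SimpleGraph V) (c : ℕ) where
  part : Fin c → G.Subgraph
  edges_nonempty : ∀ i, (part i).edgeSet.Nonempty
  edges_partition : ∀ e ∈ G.edgeSet, ∃! i, e ∈ (part i).edgeSet
  cycle_or_tree : ∀ i,
    (∃ (u : V) (p : G.Walk u u), p.IsCycle ∧ part i = p.toSubgraph) ∨ (part i).coe.IsTree
  inter_subsingleton : ∀ i j, i ≠ j → ((part i).verts ∩ (part j).verts).Subsingleton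

/-- The index of the part that contains a given edge. -/
noncomputable def Decomposition.label {G : SimpleGraph V} {c : ℕ} (D : Decomposition G c)
    (e : Sym2 V) (he : e ∈ G.edgeSet) : Fin c :=
  (D.edges_partition e he).choose

/-- A listing, without repetition, of the edges of `G` by their two end points. -/
structure EdgeListing (G : SimpleGraph V) (m : ℕ) where
  src : Fin m → V
  tgt : Fin m → V
  injective : Function.Injective fun k => s(src k, tgt k)
  range_eq : Set.range (fun k => s(src k, tgt k)) = G.edgeSet

/-- The `k`-th edge of the listing. -/
def EdgeListing.edge {G : SimpleGraph V} {m : ℕ} (L : EdgeListing G m) (k : Fin m) : Sym2 V :=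
  s(L.src k, L.tgt k)

theorem EdgeListing.edge_mem {G : SimpleGraph V} {m : ℕ} (L : EdgeListing G m) (k : Fin m) :
    L.edge k ∈ G.edgeSet :=
  L.range_eq ▸ ⟨k, rfl⟩

end Problem

/-! ### The machine model

A random access machine with registers and arrays (indirect addressing) for natural numbers, which
serve as indices, and for real numbers, which serve as weights. Each elementary instruction and each
test takes one step. The only arithmetic operations are addition and subtraction and the only
predicate is comparison, so that on rational weights the bit length of every stored number grows by
at most a constant per step. A program mentions only finitely many registers and arrays. -/

/-- Contents of the word registers, word arrays, real registers and real arrays. -/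
structure State where
  reg : ℕ → ℕ
  arr : ℕ → ℕ → ℕ
  rreg : ℕ → ℝ
  rarr : ℕ → ℕ → ℝ

/-- Elementary instructions. -/
inductive Instr where
  | skip
  | const (i c : ℕ)
  | add (i j k : ℕ)
  | sub (i j k : ℕ)
  | load (i a j : ℕ)
  | store (a i j : ℕ)
  | rzero (i : ℕ)
  | radd (i j k : ℕ)
  | rsub (i j k : ℕ)
  | rload (i a j : ℕ)
  | rstore (a i j : ℕ)

/-- The effect of an elementary instruction. -/
noncomputable def Instr.apply : Instr → State → State
  | .skip, s => s
  | .const i c, s => { s with reg := Function.update s.reg i c }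
  | .add i j k, s => { s with reg := Function.update s.reg i (s.reg j + s.reg k) }
  -- truncated subtraction of natural numbers
  | .sub i j k, s => { s with reg := Function.update s.reg i (s.reg j - s.reg k) }
  | .load i a j, s => { s with reg := Function.update s.reg i (s.arr a (s.reg j)) }
  | .store a i j, s =>
      { s with arr := Function.update s.arr a (Function.update (s.arr a) (s.reg i) (s.reg j)) }
  | .rzero i, s => { s with rreg := Function.update s.rreg i 0 }
  | .radd i j k, s => { s with rreg := Function.update s.rreg i (s.rreg j + s.rreg k) }
  | .rsub i j k, s => { s with rreg := Function.update s.rreg i (s.rreg j - s.rreg k) }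
  | .rload i a j, s => { s with rreg := Function.update s.rreg i (s.rarr a (s.reg j)) }
  | .rstore a i j, s =>
      { s with rarr := Function.update s.rarr a (Function.update (s.rarr a) (s.reg i) (s.rreg j)) }

/-- Tests: comparison of two word registers or of two real registers. -/
inductive Test where
  | lt (i j : ℕ)
  | rlt (i j : ℕ)

/-- The truth value of a test. -/
def Test.Holds : Test → State → Prop
  | .lt i j, s => s.reg i < s.reg j
  | .rlt i j, s => s.rreg i < s.rreg j

/-- Programs. -/
inductive Prog where
  | instr (a : Instr)
  | seq (P Q : Prog)
  | ite (b : Test) (P Q : Prog)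
  | loop (b : Test) (P : Prog)

/-- `Exec P s t s'`: started in state `s`, the program `P` halts after exactly `t` steps, in
state `s'`. The program `loop b P` executes `P` as long as `b` holds. -/
inductive Exec : Prog → State → ℕ → State → Prop
  | instr (a : Instr) (s : State) : Exec (.instr a) s 1 (a.apply s)
  | seq {P Q : Prog} {s s₁ s₂ : State} {t₁ t₂ : ℕ} :
      Exec P s t₁ s₁ → Exec Q s₁ t₂ s₂ → Exec (.seq P Q) s (t₁ + t₂) s₂
  | ite_true {b : Test} {P Q : Prog} {s s' : State} {t : ℕ} :
      b.Holds s → Exec P s t s' → Exec (.ite b P Q) s (t + 1) s'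
  | ite_false {b : Test} {P Q : Prog} {s s' : State} {t : ℕ} :
      ¬ b.Holds s → Exec Q s t s' → Exec (.ite b P Q) s (t + 1) s'
  | loop_true {b : Test} {P : Prog} {s s₁ s₂ : State} {t₁ t₂ : ℕ} :
      b.Holds s → Exec P s t₁ s₁ → Exec (.loop b P) s₁ t₂ s₂ →
        Exec (.loop b P) s (t₁ + t₂ + 1) s₂
  | loop_false {b : Test} {P : Prog} {s : State} :
      ¬ b.Holds s → Exec (.loop b P) s 1 s

/-- The machine is deterministic: the final state and the running time are determined. -/
theorem Exec.deterministic {P : Prog} {s s₁ s₂ : State} {t₁ t₂ : ℕ}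
    (h₁ : Exec P s t₁ s₁) (h₂ : Exec P s t₂ s₂) : t₁ = t₂ ∧ s₁ = s₂ := by
  induction h₁ generalizing t₂ s₂ with
  | instr a s => cases h₂; exact ⟨rfl, rfl⟩
  | seq _ _ ih₁ ih₂ =>
    cases h₂ with
    | seq k₁ k₂ =>
      obtain ⟨rfl, rfl⟩ := ih₁ k₁
      obtain ⟨rfl, rfl⟩ := ih₂ k₂
      exact ⟨rfl, rfl⟩
  | ite_true hb _ ih =>
    cases h₂ with
    | ite_true _ k => obtain ⟨rfl, rfl⟩ := ih k; exact ⟨rfl, rfl⟩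
    | ite_false hb' _ => exact absurd hb hb'
  | ite_false hb _ ih =>
    cases h₂ with
    | ite_true hb' _ => exact absurd hb' hb
    | ite_false _ k => obtain ⟨rfl, rfl⟩ := ih k; exact ⟨rfl, rfl⟩
  | loop_true hb _ _ ih₁ ih₂ =>
    cases h₂ with
    | loop_true _ k₁ k₂ =>
      obtain ⟨rfl, rfl⟩ := ih₁ k₁
      obtain ⟨rfl, rfl⟩ := ih₂ k₂
      exact ⟨rfl, rfl⟩
    | loop_false hb' => exact absurd hb hb'
  | loop_false hb =>
    cases h₂ with
    | loop_true hb' _ _ => exact absurd hb' hb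
    | loop_false _ => exact ⟨rfl, rfl⟩

/-! ### Input and output -/

/-- The initial state for the graph `G` on the vertices `0, …, n - 1`, with root `r`, weights `γ`
and `τ`, and the decomposition `D` supplied by the oracle. The registers `0` to `3` hold the number
of vertices, of edges and of parts, and the root; the word arrays `0` and `1` hold the end points of
the edges, the word array `2` the part to which each edge belongs; the real arrays `0` and `1` hold
the cable and trench costs of the edges. Everything else is `0`. -/
noncomputable def inputState {n m c : ℕ} {G : SimpleGraph (Fin n)} (L : EdgeListing G m)
    (D : Decomposition G c) (γ τ : Sym2 (Fin n) → ℝ) (r : Fin n) : State where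
  reg
    | 0 => n
    | 1 => m
    | 2 => c
    | 3 => r
    | _ => 0
  arr a k :=
    if h : k < m then
      match a with
      | 0 => L.src ⟨k, h⟩
      | 1 => L.tgt ⟨k, h⟩
      | 2 => D.label (L.edge ⟨k, h⟩) (L.edge_mem ⟨k, h⟩)
      | _ => 0
    else 0
  rreg _ := 0
  rarr a k :=
    if h : k < m then
      match a with
      | 0 => γ (L.edge ⟨k, h⟩)
      | 1 => τ (L.edge ⟨k, h⟩)
      | _ => 0
    else 0

/-- The graph that a final state describes: its edges are those listed edges whose entry in the word
array `3` is `1`. -/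
def outputGraph {n m : ℕ} {G : SimpleGraph (Fin n)} (L : EdgeListing G m) (s : State) :
    SimpleGraph (Fin n) :=
  SimpleGraph.fromEdgeSet {e | ∃ k : Fin m, s.arr 3 k = 1 ∧ e = L.edge k}

end CableTrench

namespace CableTrench

/-! ### Spanning trees of cactus graphs -/

section Trees

open SimpleGraph

variable {V : Type*}

/-! Counting each cable edge once for every vertex it serves turns the cost of a spanning tree T
into a sum over its edges f of τ f plus γ f times the number of vertices that T - f separates from
the root (`cost_eq_sum`). In a cactus this number depends very little on T. If f is a bridge of G,
it is read off from G - f. Otherwise exactly one omitted edge e joins the two sides of T - f, since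
two such edges would give two distinct cycles through f; the number is then `cut G r e f`, while
every other omitted edge e' has `cut G r e' f = 0` (`IsCactus.exists_partner`). The number of
omitted edges is the same for all spanning trees, so the bridge terms sum to a constant, and the
cost is a constant plus the sum over omitted edges of a `penalty` that does not mention T
(`IsCactus.cost_eq`). Hence an optimal tree omits an edge of least penalty from each cycle. Two
edges that are not bridges share a cycle exactly when removing both disconnects G, so this rule
needs only the numbers `cut`. Ties are broken by the numbering of the edges, and an exchange
argument proves the resulting tree optimal. The program finds each `cut` by marking the vertices
reachable from the root, sums the penalties, and compares all pairs of edges. Its time is polynomial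
in n and m, and m ≤ n². -/

theorem reachable_of_forall_adj {H K : SimpleGraph V} (h : ∀ a b, H.Adj a b → K.Reachable a b)
    {a b : V} (hab : H.Reachable a b) : K.Reachable a b := by
  obtain ⟨p⟩ := hab
  induction p with
  | nil => exact Reachable.refl _
  | cons hadj _ ih => exact (h _ _ hadj).trans ih

/-- An edge lies on the path between two vertices of a tree iff its removal separates them. -/
theorem mem_edges_iff_not_reachable {T : SimpleGraph V} (hT : T.IsTree) {u v : V}
    {p : T.Walk u v} (hp : p.IsPath) (e : Sym2 V) :
    e ∈ p.edges ↔ ¬ (T.deleteEdges {e}).Reachable u v := by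
  constructor
  · intro he hr
    obtain ⟨q, hq⟩ := hr.exists_isPath
    have hle : T.deleteEdges {e} ≤ T := deleteEdges_le _
    have := (hT.existsUnique_path u v).unique hp (hq.mapLe hle)
    subst this
    rw [Walk.edges_mapLe_eq_edges] at he
    have := q.edges_subset_edgeSet he
    simp [edgeSet_deleteEdges] at this
  · intro h
    by_contra he
    exact h ⟨p.toDeleteEdge e he⟩

/-- The number of vertices that are not reachable from `r`. -/
noncomputable def unreached [Fintype V] (H : SimpleGraph V) (r : V) : ℕ :=
  open Classical in (Finset.univ.filter fun w => ¬ H.Reachable r w).card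

theorem unreached_eq_zero_iff [Fintype V] {H : SimpleGraph V} {r : V} :
    unreached H r = 0 ↔ H.Connected := by
  classical
  have : Nonempty V := ⟨r⟩
  simp only [unreached, Finset.card_eq_zero, Finset.filter_eq_empty_iff, Finset.mem_univ,
    true_imp_iff, not_not]
  exact ⟨fun h => ⟨fun a b => (h (x := a)).symm.trans (h (x := b))⟩, fun h w => h.preconnected r w⟩

theorem unreached_congr [Fintype V] {H K : SimpleGraph V} {r : V}
    (h : ∀ w, H.Reachable r w ↔ K.Reachable r w) : unreached H r = unreached K r := by
  classical
  simp only [unreached, h]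

-- The edges of the path from u to v are the tree edges whose removal separates u from v, so the
-- path can be replaced by a sum over all tree edges.
open Classical in
theorem cableLength_eq_sum [Fintype V] {T : SimpleGraph V} (hT : T.IsTree) (γ : Sym2 V → ℝ)
    (u v : V) : cableLength hT γ u v =
      ∑ e ∈ T.edgeFinset, if (T.deleteEdges {e}).Reachable u v then 0 else γ e := by
  have hp : (hT.existsUnique_path u v).choose.IsPath := (hT.existsUnique_path u v).choose_spec.1
  rw [cableLength]
  generalize (hT.existsUnique_path u v).choose = p at hp
  rw [← List.sum_toFinset _ hp.isTrail.edges_nodup]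
  have : p.edges.toFinset =
      T.edgeFinset.filter fun e => ¬ (T.deleteEdges {e}).Reachable u v := by
    ext e
    simp only [List.mem_toFinset, Finset.mem_filter, mem_edgeFinset,
      ← mem_edges_iff_not_reachable hT hp]
    exact ⟨fun h => ⟨p.edges_subset_edgeSet h, h⟩, And.right⟩
  rw [this, Finset.sum_filter]
  exact Finset.sum_congr rfl fun e _ => by split_ifs <;> simp_all

-- Double counting: after the order of summation is exchanged, γ e occurs once for each vertex that
-- loses its connection to r in T - e.
open Classical in
theorem cost_eq_sum [Fintype V] {T : SimpleGraph V} (hT : T.IsTree) (γ τ : Sym2 V → ℝ) (r : V) :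
    cost hT γ τ r = ∑ e ∈ T.edgeFinset, τ e +
      ∑ e ∈ T.edgeFinset, γ e * unreached (T.deleteEdges {e}) r := by
  rw [cost]
  congr 1
  · rw [finsum_mem_eq_sum_of_inter_support_eq]
    simp
  · simp_rw [cableLength_eq_sum]
    rw [Finset.sum_comm]
    refine Finset.sum_congr rfl fun e _ => ?_
    rw [unreached, Finset.card_filter]
    push_cast
    rw [Finset.mul_sum]
    refine Finset.sum_congr rfl fun w _ => ?_
    by_cases h : (T.deleteEdges {e}).Reachable r w <;> simp [h]

/-- Removing a tree edge leaves two components; any edge between them reconnects the tree. -/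
theorem connected_of_crossing {T K : SimpleGraph V} (hT : T.Connected) {f : Sym2 V} {c d : V}
    (hle : T.deleteEdges {f} ≤ K) (hcd : ¬ (T.deleteEdges {f}).Reachable c d) (hK : K.Adj c d) :
    K.Connected := by
  induction f using Sym2.ind with | _ a b => ?_
  -- A walk in T from w towards a either avoids f or meets an end of f before its first passage
  -- through f.
  have hside : ∀ w, (T.deleteEdges {s(a, b)}).Reachable w a ∨
      (T.deleteEdges {s(a, b)}).Reachable w b := by
    intro w
    obtain ⟨p⟩ := hT.preconnected w a
    induction p with
    | nil => exact Or.inl (Reachable.refl _)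
    | @cons x y a hadj _ ih =>
      by_cases hxy : s(x, y) = s(a, b)
      · rcases Sym2.eq_iff.1 hxy with ⟨rfl, rfl⟩ | ⟨rfl, rfl⟩
        · exact Or.inl (Reachable.refl _)
        · exact Or.inr (Reachable.refl _)
      · have : (T.deleteEdges {s(a, b)}).Adj x y := by simp [deleteEdges_adj, hadj, hxy]
        exact (ih hle hcd).imp this.reachable.trans this.reachable.trans
  have hab : K.Reachable a b := by
    rcases hside c with hc | hc <;> rcases hside d with hd | hd
    · exact absurd (hc.trans hd.symm) hcd
    · exact ((hc.mono hle).symm.trans hK.reachable).trans (hd.mono hle)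
    · exact ((hd.mono hle).symm.trans hK.symm.reachable).trans (hc.mono hle)
    · exact absurd (hc.trans hd.symm) hcd
  have := hT.nonempty
  refine ⟨fun x y => ?_⟩
  have key : ∀ w, K.Reachable w a := fun w =>
    (hside w).elim (fun h => h.mono hle) fun h => (h.mono hle).trans hab.symm
  exact (key x).trans (key y).symm

theorem not_reachable_of_mem_tree {T : SimpleGraph V} (hT : T.IsTree) {a b : V} (h : T.Adj a b) :
    ¬ (T.deleteEdges {s(a, b)}).Reachable a b := by
  rw [← mem_edges_iff_not_reachable hT (Walk.IsPath.of_adj h)]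
  simp

theorem not_connected_deleteEdges_of_mem_tree {T : SimpleGraph V} (hT : T.IsTree) {f : Sym2 V}
    (hf : f ∈ T.edgeSet) : ¬ (T.deleteEdges {f}).Connected := by
  induction f using Sym2.ind with | _ a b => ?_
  exact fun h => not_reachable_of_mem_tree hT hf (h.preconnected a b)

/-- Replacing a tree edge by an edge between the two resulting components yields a tree. -/
theorem isTree_exchange [Finite V] {T : SimpleGraph V} (hT : T.IsTree) {f : Sym2 V}
    (hf : f ∈ T.edgeSet) {c d : V} (hne : c ≠ d) (hcd : ¬ (T.deleteEdges {f}).Reachable c d) :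
    (fromEdgeSet (insert s(c, d) (T.edgeSet \ {f}))).IsTree := by
  have hset : (fromEdgeSet (insert s(c, d) (T.edgeSet \ {f}))).edgeSet =
      insert s(c, d) (T.edgeSet \ {f}) := by
    rw [edgeSet_fromEdgeSet, sdiff_eq_left, Set.disjoint_left]
    rintro e (rfl | he) hd
    · exact hne hd
    · exact T.not_isDiag_of_mem_edgeSet he.1 hd
  have hnot : s(c, d) ∉ T.edgeSet \ {f} := fun h => hcd <| Adj.reachable <| by
    simpa [deleteEdges_adj] using h
  -- The exchange keeps the number of edges, so connectedness is all that has to be proved.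
  rw [isTree_iff_connected_and_card]
  refine ⟨connected_of_crossing hT.connected ?_ hcd ?_, ?_⟩
  · intro x y h
    simp only [deleteEdges_adj, Set.mem_singleton_iff] at h
    simp only [fromEdgeSet_adj, Set.mem_insert_iff, Set.mem_sdiff, mem_edgeSet,
      Set.mem_singleton_iff]
    exact ⟨Or.inr h, h.1.ne⟩
  · simp [hne]
  · have h := (isTree_iff_connected_and_card.1 hT).2
    rw [hset, Nat.card_coe_set_eq, Set.ncard_insert_of_notMem hnot,
      Set.ncard_sdiff_singleton_add_one hf, ← Nat.card_coe_set_eq, h]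

/-- In a cactus graph, at most one non-tree edge joins the two components that arise from a
spanning tree by the removal of an edge. -/
theorem IsCactus.crossing_unique {G T : SimpleGraph V} (hG : IsCactus G) (hT : T.IsTree)
    (hle : T ≤ G) {f : Sym2 V} {a b c d : V} (hab : G.Adj a b) (hcd : G.Adj c d)
    (hab' : s(a, b) ∉ T.edgeSet) (hcd' : s(c, d) ∉ T.edgeSet)
    (h₁ : ¬ (T.deleteEdges {f}).Reachable a b) (h₂ : ¬ (T.deleteEdges {f}).Reachable c d) :
    s(a, b) = s(c, d) := by
  -- The fundamental cycle of a crossing non-tree edge passes through f and has no other non-tree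
  -- edge. Two such cycles share f, so in a cactus they have the same edges and hence the same
  -- non-tree edge.
  have key : ∀ x y : V, G.Adj x y → s(x, y) ∉ T.edgeSet → ¬ (T.deleteEdges {f}).Reachable x y →
      ∃ p : G.Walk x x, p.IsCycle ∧ f ∈ p.edges ∧ s(x, y) ∈ p.edges ∧
        ∀ e ∈ p.edges, e ∉ T.edgeSet → e = s(x, y) := by
    intro x y hxy hn hr
    obtain ⟨p, hp, -⟩ := hT.existsUnique_path y x
    have hr' : ¬ (T.deleteEdges {f}).Reachable y x := fun h => hr h.symm
    have hf := (mem_edges_iff_not_reachable hT hp f).2 hr'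
    refine ⟨Walk.cons hxy (p.mapLe hle), (Walk.cons_isCycle_iff _ _).2 ⟨hp.mapLe hle, ?_⟩, ?_, ?_,
      ?_⟩
    · rw [Walk.edges_mapLe_eq_edges]
      exact fun h => hn (p.edges_subset_edgeSet h)
    · simp [hf]
    · simp
    · intro e he heT
      rw [Walk.edges_cons, Walk.edges_mapLe_eq_edges, List.mem_cons] at he
      exact he.resolve_right fun h => heT (p.edges_subset_edgeSet h)
  obtain ⟨p, hp, hfp, hep, -⟩ := key a b hab hab' h₁
  obtain ⟨q, hq, hfq, -, hq'⟩ := key c d hcd hcd' h₂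
  exact hq' _ ((hG.2 _ _ p q hp hq ⟨f, hfp, hfq⟩ _).1 hep) hab'

end Trees

/-! ### The cost of a spanning tree of a cactus graph -/

section Cost

open SimpleGraph

theorem deleteEdges_le_deleteEdges_pair {V : Type*} {G T : SimpleGraph V}
    {e f : Sym2 V} (hle : T ≤ G) (he : e ∉ T.edgeSet) : T.deleteEdges {f} ≤ G.deleteEdges {e, f} := by
  intro x y h
  simp only [deleteEdges_adj, Set.mem_insert_iff, Set.mem_singleton_iff] at h ⊢
  refine ⟨hle h.1, ?_⟩
  rintro (rfl | h')
  exacts [he h.1, h.2 h']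

variable {V : Type*} [Fintype V]

/-- The number of vertices that are separated from `r` by the removal of the edges `e` and `f`. -/
noncomputable def cut (G : SimpleGraph V) (r : V) (e f : Sym2 V) : ℕ :=
  unreached (G.deleteEdges {e, f}) r

variable {G T : SimpleGraph V} {r : V} {e f : Sym2 V}

theorem cut_eq_zero_of_notMem (hT : T.IsTree) (hle : T ≤ G) (he : e ∉ T.edgeSet)
    (hf : f ∉ T.edgeSet) : cut G r e f = 0 := by
  refine unreached_eq_zero_iff.2 (hT.connected.mono fun x y h => ?_)
  simp only [deleteEdges_adj, Set.mem_insert_iff, Set.mem_singleton_iff]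
  refine ⟨hle h, ?_⟩
  rintro (rfl | rfl)
  exacts [he h, hf h]

/-- A tree edge that is not a bridge is bypassed by some non-tree edge. -/
theorem exists_crossing (hT : T.IsTree) (hf : f ∈ T.edgeSet)
    (hcut : cut G r f f = 0) :
    ∃ c d, G.Adj c d ∧ s(c, d) ∉ T.edgeSet ∧ s(c, d) ≠ f ∧
      ¬ (T.deleteEdges {f}).Reachable c d := by
  by_contra! hno
  -- Without a crossing edge, every edge of the connected graph G - f could be replaced by a walk in
  -- T - f.
  refine not_connected_deleteEdges_of_mem_tree hT hf ?_
  have hG : (G.deleteEdges {f, f}).Connected := unreached_eq_zero_iff.1 hcut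
  have := hG.nonempty
  refine ⟨fun x y => reachable_of_forall_adj ?_ (hG.preconnected x y)⟩
  intro a b hab
  simp only [deleteEdges_adj, Set.pair_eq_singleton, Set.mem_singleton_iff] at hab
  by_cases hT' : T.Adj a b
  · exact Adj.reachable (by simp [deleteEdges_adj, hT', hab.2])
  · exact hno a b hab.1 hT' hab.2

/-- Every edge of G - {e, f} lies in T - f or has its ends joined there, so both graphs have the
same components. -/
theorem cut_eq_unreached_of_forall (hle : T ≤ G) (he : e ∉ T.edgeSet)
    (h : ∀ a b, G.Adj a b → s(a, b) ∉ T.edgeSet → s(a, b) ≠ e → s(a, b) ≠ f →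
      (T.deleteEdges {f}).Reachable a b) :
    cut G r e f = unreached (T.deleteEdges {f}) r := by
  refine unreached_congr fun w =>
    ⟨reachable_of_forall_adj fun a b hab => ?_, fun h => h.mono ?_⟩
  · simp only [deleteEdges_adj, Set.mem_insert_iff, Set.mem_singleton_iff, not_or] at hab
    by_cases hT' : T.Adj a b
    · exact Adj.reachable (by simp [deleteEdges_adj, hT', hab.2])
    · exact h a b hab.1 hT' hab.2.1 hab.2.2
  · exact deleteEdges_le_deleteEdges_pair hle he

/-- If a non-tree edge bypasses `f`, removing `f` and another non-tree edge keeps the graph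
connected. -/
theorem cut_eq_zero_of_crossing (hle : T ≤ G) (hT : T.IsTree) (he : e ∉ T.edgeSet) {c d : V}
    (hcd : G.Adj c d) (hne : s(c, d) ≠ e) (hnf : s(c, d) ≠ f)
    (hcr : ¬ (T.deleteEdges {f}).Reachable c d) : cut G r e f = 0 :=
  unreached_eq_zero_iff.2 <| connected_of_crossing hT.connected
    (deleteEdges_le_deleteEdges_pair hle he) hcr (by simp [deleteEdges_adj, hcd, hne, hnf])

/-- A bridge separates the same vertices whichever non-tree edge is removed in addition. -/
theorem cut_eq_of_bridge (hle : T ≤ G) (hT : T.IsTree) (hcut : cut G r f f ≠ 0)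
    (he : e ∉ T.edgeSet) :
    cut G r e f = unreached (T.deleteEdges {f}) r ∧
      cut G r f f = unreached (T.deleteEdges {f}) r := by
  have key : ∀ a b, G.Adj a b → s(a, b) ∉ T.edgeSet → s(a, b) ≠ f →
      (T.deleteEdges {f}).Reachable a b := by
    intro a b hab hT' hf
    by_contra hcr
    refine hcut (unreached_eq_zero_iff.2 <| connected_of_crossing hT.connected ?_ hcr
      (by simp [deleteEdges_adj, hab, hf]))
    rw [Set.pair_eq_singleton]
    exact fun x y h => ⟨hle h.1, h.2⟩
  refine ⟨cut_eq_unreached_of_forall hle he fun a b h h' _ => key a b h h', ?_⟩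
  refine unreached_congr fun w =>
    ⟨reachable_of_forall_adj fun a b hab => ?_, fun h => h.mono ?_⟩
  · simp only [deleteEdges_adj, Set.pair_eq_singleton, Set.mem_singleton_iff] at hab
    by_cases hT' : T.Adj a b
    · exact Adj.reachable (by simp [deleteEdges_adj, hT', hab.2])
    · exact key a b hab.1 hT' hab.2
  · rw [Set.pair_eq_singleton]
    exact fun x y h => ⟨hle h.1, h.2⟩

/-- In a cactus graph, every tree edge that is not a bridge forms a cut with exactly one
non-tree edge. -/
theorem IsCactus.exists_partner (hG : IsCactus G) (hle : T ≤ G) (hT : T.IsTree)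
    (hf : f ∈ T.edgeSet) (hcut : cut G r f f = 0) :
    ∃ e ∈ G.edgeSet, e ∉ T.edgeSet ∧ cut G r e f = unreached (T.deleteEdges {f}) r ∧
      ∀ e' ∉ T.edgeSet, e' ≠ e → cut G r e' f = 0 := by
  obtain ⟨c, d, hcd, hcdT, hcdf, hcr⟩ := exists_crossing hT hf hcut
  refine ⟨s(c, d), hcd, hcdT, cut_eq_unreached_of_forall hle hcdT fun a b hab habT hne hnf => ?_,
    fun e' he' hne => cut_eq_zero_of_crossing hle hT he' hcd hne.symm hcdf hcr⟩
  by_contra h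
  exact hne (hG.crossing_unique hT hle hab hcd habT hcdT h hcr)

/-- Any non-tree edge that forms a cut together with a tree edge `f` that is not a bridge can be
exchanged with `f`. -/
theorem exchange_of_cut_ne_zero (hle : T ≤ G) (hT : T.IsTree) (he : e ∈ G.edgeSet)
    (he' : e ∉ T.edgeSet) (hcut : cut G r f f = 0) (hne : cut G r e f ≠ 0) :
    f ∈ T.edgeSet ∧ (fromEdgeSet (insert e (T.edgeSet \ {f}))).IsTree := by
  have hf : f ∈ T.edgeSet := by
    by_contra hf
    exact hne (cut_eq_zero_of_notMem hT hle he' hf)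
  refine ⟨hf, ?_⟩
  obtain ⟨c, d, hcd, hcdT, hcdf, hcr⟩ := exists_crossing hT hf hcut
  by_cases h : s(c, d) = e
  · subst h
    exact isTree_exchange hT hf hcd.ne hcr
  · exact absurd (cut_eq_zero_of_crossing hle hT he' hcd h hcdf hcr) hne

/-! ### The cost as a sum over the omitted edges -/

open Classical in
/-- Up to an additive constant, the increase of the cost that is due to the omission of `e`. -/
noncomputable def penalty (G : SimpleGraph V) (γ τ : Sym2 V → ℝ) (r : V) (e : Sym2 V) : ℝ :=
  ∑ f ∈ G.edgeFinset, γ f * cut G r e f - τ e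

-- For a tree edge f that is not a bridge, only its partner contributes on the left and the last
-- term vanishes. For a bridge all summands on the left equal the separated number, and the last
-- term corrects the multiplicity. For f outside T everything vanishes, since T survives the removal
-- of both edges.
open Classical in
theorem IsCactus.sum_cut (hG : IsCactus G) (hle : T ≤ G) (hT : T.IsTree) (f : Sym2 V) :
    (∑ e ∈ G.edgeFinset \ T.edgeFinset, cut G r e f : ℝ) =
      (if f ∈ T.edgeFinset then (unreached (T.deleteEdges {f}) r : ℝ) else 0) +
        (((G.edgeFinset \ T.edgeFinset).card : ℝ) - 1) * cut G r f f := by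
  by_cases hf : f ∈ T.edgeSet
  · rw [if_pos (mem_edgeFinset.2 hf)]
    by_cases hcut : cut G r f f = 0
    · obtain ⟨e, he, heT, h₁, h₂⟩ := hG.exists_partner hle hT hf hcut
      rw [Finset.sum_eq_single_of_mem e (by simp [he, heT])]
      · simp [h₁, hcut]
      · intro e' he' hne
        rw [h₂ e' (by simp_all) hne, Nat.cast_zero]
    · rw [Finset.sum_congr rfl fun e he => by
        rw [(cut_eq_of_bridge hle hT hcut (e := e) (by simp_all)).1]]
      -- The loop at r serves as a non-edge of T even if T = G.
      obtain ⟨v, hv⟩ : ∃ e, e ∉ T.edgeSet := ⟨s(r, r), by simp⟩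
      rw [(cut_eq_of_bridge hle hT hcut hv).2]
      simp
      ring
  · rw [if_neg (by simpa using hf), cut_eq_zero_of_notMem hT hle hf hf, Finset.sum_eq_zero]
    · simp
    · intro e he
      rw [cut_eq_zero_of_notMem hT hle (by simp_all) hf, Nat.cast_zero]

open Classical in
/-- The cost of a spanning tree of a cactus graph is, up to a constant, the sum of the penalties of
the omitted edges. -/
theorem IsCactus.cost_eq (hG : IsCactus G) (γ τ : Sym2 V → ℝ) (hle : T ≤ G) (hT : T.IsTree) :
    cost hT γ τ r = ∑ e ∈ G.edgeFinset \ T.edgeFinset, penalty G γ τ r e +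
      (∑ e ∈ G.edgeFinset, τ e - ((G.edgeFinset.card : ℝ) - Fintype.card V) *
        ∑ f ∈ G.edgeFinset, γ f * cut G r f f) := by
  have hsub : T.edgeFinset ⊆ G.edgeFinset := edgeFinset_mono hle
  -- All spanning trees omit the same number of edges, which makes the correction term a constant.
  have hcard : ((G.edgeFinset \ T.edgeFinset).card : ℝ) - 1 =
      (G.edgeFinset.card : ℝ) - Fintype.card V := by
    rw [Finset.card_sdiff_of_subset hsub, Nat.cast_sub (Finset.card_le_card hsub),
      ← hT.card_edgeFinset]
    push_cast
    ring
  simp only [penalty, Finset.sum_sub_distrib]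
  rw [Finset.sum_comm]
  simp_rw [← Finset.mul_sum, hG.sum_cut hle hT, hcard, mul_add, mul_ite, mul_zero,
    Finset.sum_add_distrib]
  rw [← Finset.sum_filter, Finset.filter_mem_eq_inter, Finset.inter_eq_right.2 hsub,
    cost_eq_sum, ← Finset.sum_sdiff hsub (f := τ), Finset.mul_sum]
  simp_rw [mul_left_comm]
  ring

/-! ### Optimality of omitting the best edge of each cycle -/

/-- `f` is a better candidate for omission than `e`; ties are broken by the numbering `idx`. -/
def Better (w : Sym2 V → ℝ) (idx : Sym2 V → ℕ) (f e : Sym2 V) : Prop :=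
  w f < w e ∨ ¬ w e < w f ∧ idx f < idx e

/-- The edges that are omitted: those which are not bridges and are the best candidates on their
cycles. -/
def omitted (G : SimpleGraph V) (γ τ : Sym2 V → ℝ) (r : V) (idx : Sym2 V → ℕ) : Set (Sym2 V) :=
  {e | e ∈ G.edgeSet ∧ cut G r e e = 0 ∧ ∀ f ∈ G.edgeSet, cut G r f f = 0 → cut G r e f ≠ 0 →
    ¬ Better (penalty G γ τ r) idx f e}

theorem cut_comm : cut G r e f = cut G r f e := by
  rw [cut, Set.pair_comm, ← cut]

-- A spanning tree S for which the omitted edges are lexicographically minimal in total penalty,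
-- then total index, is shown to omit exactly the set `omitted`. Its cost is minimal because cost
-- and total penalty differ by a constant.
open Classical in
theorem IsCactus.isCableTrenchTree_deleteEdges_omitted (hG : IsCactus G) (γ τ : Sym2 V → ℝ) (r : V)
    {idx : Sym2 V → ℕ} (hidx : Set.InjOn idx G.edgeSet) :
    IsCableTrenchTree G γ τ r (G.deleteEdges (omitted G γ τ r idx)) := by
  set w := penalty G γ τ r with hw
  let val : SimpleGraph V → ℝ ×ₗ ℕ := fun S =>
    toLex (∑ e ∈ G.edgeFinset \ S.edgeFinset, w e, ∑ e ∈ G.edgeFinset \ S.edgeFinset, idx e)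
  obtain ⟨S₀, hS₀, hS₀T⟩ := hG.1.exists_isTree_le
  obtain ⟨S, ⟨hS, hST⟩, hmin⟩ := Set.exists_min_image {S : SimpleGraph V | S ≤ G ∧ S.IsTree} val
    (Set.toFinite _) ⟨S₀, hS₀, hS₀T⟩
  -- If some f ruled out e, then f would lie in S, and omitting f in place of e would decrease
  -- `val`.
  have hbest : ∀ e ∈ G.edgeSet, e ∉ S.edgeSet → e ∈ omitted G γ τ r idx := by
    intro e he heS
    refine ⟨he, cut_eq_zero_of_notMem hST hS heS heS, fun f hf hff hef hbet => ?_⟩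
    obtain ⟨hfS, hT⟩ := exchange_of_cut_ne_zero hS hST he heS hff hef
    generalize hR : fromEdgeSet (insert e (S.edgeSet \ {f})) = R at hT
    have hset : R.edgeSet =
        insert e (S.edgeSet \ {f}) := by
      rw [← hR, edgeSet_fromEdgeSet, sdiff_eq_left, Set.disjoint_left]
      rintro x (rfl | hx) hd
      · exact G.not_isDiag_of_mem_edgeSet he hd
      · exact S.not_isDiag_of_mem_edgeSet hx.1 hd
    have hne : e ≠ f := fun h => heS (h ▸ hfS)
    have hfin : G.edgeFinset \ R.edgeFinset =
        insert f ((G.edgeFinset \ S.edgeFinset).erase e) := by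
      ext x
      simp only [Finset.mem_sdiff, mem_edgeFinset, hset, Finset.mem_insert, Finset.mem_erase,
        Set.mem_insert_iff, Set.mem_sdiff, Set.mem_singleton_iff]
      by_cases hx : x = f
      · subst hx
        simp [hf, hne.symm]
      · simp [hx]
        tauto
    -- Stated without subtraction, so that it applies both to the real penalties and to the natural
    -- indices.
    have hsum : ∀ {M : Type} [AddCommMonoid M] (g : Sym2 V → M),
        ∑ x ∈ G.edgeFinset \ R.edgeFinset, g x + g e =
          ∑ x ∈ G.edgeFinset \ S.edgeFinset, g x + g f := by
      intro M _ g
      rw [hfin, Finset.sum_insert (by simp [hfS]), add_assoc,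
        Finset.sum_erase_add _ _ (by simp [he, heS]), add_comm]
    have hle : R ≤ G := by
      rw [← edgeSet_subset_edgeSet, hset]
      rintro x (rfl | hx)
      exacts [he, edgeSet_mono hS hx.1]
    have h := hmin _ ⟨hle, hT⟩
    rw [Prod.Lex.le_iff] at h
    simp only [val, ofLex_toLex] at h
    have h₁ := hsum w
    have h₂ := hsum idx
    rcases hbet with hb | ⟨hb₁, hb₂⟩
    · rcases h with h | ⟨h, -⟩ <;> linarith
    · rcases h with h | ⟨h, h'⟩
      · exact hb₁ (by linarith)
      · omega
  have hdel : G.deleteEdges (omitted G γ τ r idx) = S := by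
    rw [← edgeSet_inj, edgeSet_deleteEdges]
    ext x
    constructor
    · rintro ⟨hx, hxo⟩
      by_contra hxS
      exact hxo (hbest x hx hxS)
    · refine fun hx => ⟨edgeSet_mono hS hx, fun hxo => ?_⟩
      -- The partner e of x is also in `omitted`, so neither edge is better than the other. Their
      -- indices then agree, which forces e = x although only x lies in S.
      obtain ⟨e, he, heS, hcut, -⟩ := hG.exists_partner hS hST hx hxo.2.1
      have heo := hbest e he heS
      have hcut' : cut G r e x ≠ 0 := by
        rw [hcut, Ne, unreached_eq_zero_iff]
        exact not_connected_deleteEdges_of_mem_tree hST hx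
      have h₁ := heo.2.2 x hxo.1 hxo.2.1 hcut'
      have h₂ := hxo.2.2 e he heo.2.1 (by rwa [cut_comm])
      simp only [Better, not_or, not_and, not_lt] at h₁ h₂
      have := hidx he hxo.1 (le_antisymm (h₁.2 h₂.1) (h₂.2 h₁.1))
      exact heS (this ▸ hx)
  rw [hdel]
  refine ⟨hST, hS, fun R hR hRG => ?_⟩
  rw [hG.cost_eq γ τ hS, hG.cost_eq γ τ hRG]
  have h := hmin R ⟨hRG, hR⟩
  rw [Prod.Lex.le_iff] at h
  simp only [val, ofLex_toLex] at h
  rcases h with h | ⟨h, -⟩ <;> linarith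

end Cost

/-! ### Reasoning about programs -/

section Machine

/-- Word registers that an instruction may change. -/
def Instr.wreg : Instr → List ℕ
  | .const i _ | .add i _ _ | .sub i _ _ | .load i _ _ => [i]
  | _ => []

/-- Word arrays that an instruction may change. -/
def Instr.warr : Instr → List ℕ
  | .store a _ _ => [a]
  | _ => []

/-- Real registers that an instruction may change. -/
def Instr.wrreg : Instr → List ℕ
  | .rzero i | .radd i _ _ | .rsub i _ _ | .rload i _ _ => [i]
  | _ => []

/-- Real arrays that an instruction may change. -/
def Instr.wrarr : Instr → List ℕ
  | .rstore a _ _ => [a]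
  | _ => []

/-- The list of the values of `f` at the instructions of a program. -/
def Prog.collect (f : Instr → List ℕ) : Prog → List ℕ
  | .instr a => f a
  | .seq P Q => P.collect f ++ Q.collect f
  | .ite _ P Q => P.collect f ++ Q.collect f
  | .loop _ P => P.collect f

/-- One induction covers all four kinds of cells: f lists the cells an instruction may write, and g
reads a cell outside that list. -/
theorem Exec.preserves {α : Type*} {f : Instr → List ℕ} {i : ℕ} {g : State → α}
    (hg : ∀ a s, i ∉ f a → g (a.apply s) = g s) {P : Prog} {s s' : State} {t : ℕ}
    (h : Exec P s t s') (hi : i ∉ P.collect f) : g s' = g s := by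
  induction h with
  | instr a s => exact hg a s hi
  | seq _ _ ih₁ ih₂ =>
    simp only [Prog.collect, List.mem_append, not_or] at hi
    rw [ih₂ hi.2, ih₁ hi.1]
  | ite_true _ _ ih =>
    simp only [Prog.collect, List.mem_append, not_or] at hi
    exact ih hi.1
  | ite_false _ _ ih =>
    simp only [Prog.collect, List.mem_append, not_or] at hi
    exact ih hi.2
  | loop_true _ _ _ ih₁ ih₂ => rw [ih₂ hi, ih₁ hi]
  | loop_false _ => rfl

theorem Exec.reg_eq {P : Prog} {s s' : State} {t i : ℕ} (h : Exec P s t s')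
    (hi : i ∉ P.collect Instr.wreg) : s'.reg i = s.reg i :=
  h.preserves (g := fun s => s.reg i)
    (fun a s hi => by cases a <;> simp_all [Instr.apply, Instr.wreg]) hi

theorem Exec.arr_eq {P : Prog} {s s' : State} {t i : ℕ} (h : Exec P s t s')
    (hi : i ∉ P.collect Instr.warr) : s'.arr i = s.arr i :=
  h.preserves (g := fun s => s.arr i)
    (fun a s hi => by cases a <;> simp_all [Instr.apply, Instr.warr]) hi

theorem Exec.rreg_eq {P : Prog} {s s' : State} {t i : ℕ} (h : Exec P s t s')
    (hi : i ∉ P.collect Instr.wrreg) : s'.rreg i = s.rreg i :=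
  h.preserves (g := fun s => s.rreg i)
    (fun a s hi => by cases a <;> simp_all [Instr.apply, Instr.wrreg]) hi

theorem Exec.rarr_eq {P : Prog} {s s' : State} {t i : ℕ} (h : Exec P s t s')
    (hi : i ∉ P.collect Instr.wrarr) : s'.rarr i = s.rarr i :=
  h.preserves (g := fun s => s.rarr i)
    (fun a s hi => by cases a <;> simp_all [Instr.apply, Instr.wrarr]) hi

/-- Started in `s`, the program `P` halts after at most `B` steps in a state with the property
`Q`. -/
def Runs (P : Prog) (s : State) (B : ℕ) (Q : State → Prop) : Prop :=
  ∃ t s', t ≤ B ∧ Exec P s t s' ∧ Q s'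

variable {P P' : Prog} {s : State} {B B' : ℕ} {Q Q' : State → Prop}

theorem Runs.instr {a : Instr} (h : Q (a.apply s)) : Runs (.instr a) s 1 Q :=
  ⟨1, _, le_rfl, .instr a s, h⟩

theorem Runs.mono (h : Runs P s B Q) (hB : B ≤ B') (hQ : ∀ s', Q s' → Q' s') : Runs P s B' Q' := by
  obtain ⟨t, s', ht, he, hq⟩ := h
  exact ⟨t, s', ht.trans hB, he, hQ _ hq⟩

theorem Runs.of_le (h : Runs P s B Q) (hB : B ≤ B') : Runs P s B' Q := h.mono hB fun _ => id

theorem Runs.seq (h : Runs P s B fun s' => Runs P' s' B' Q) : Runs (.seq P P') s (B + B') Q := by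
  obtain ⟨t, s', ht, he, t', s'', ht', he', hq⟩ := h
  exact ⟨t + t', s'', add_le_add ht ht', .seq he he', hq⟩

theorem Runs.instr_seq {a : Instr} (h : Runs P (a.apply s) B Q) :
    Runs (.seq (.instr a) P) s (B + 1) Q :=
  (Runs.seq (Runs.instr h)).of_le (by omega)

theorem Runs.ite {b : Test} (h₁ : b.Holds s → Runs P s B Q) (h₂ : ¬ b.Holds s → Runs P' s B Q) :
    Runs (.ite b P P') s (B + 1) Q := by
  by_cases hb : b.Holds s
  · obtain ⟨t, s', ht, he, hq⟩ := h₁ hb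
    exact ⟨t + 1, s', by omega, .ite_true hb he, hq⟩
  · obtain ⟨t, s', ht, he, hq⟩ := h₂ hb
    exact ⟨t + 1, s', by omega, .ite_false hb he, hq⟩

/-- The states `s` and `s'` agree on all cells that are not changed by `P`. -/
structure Frame (P : Prog) (s s' : State) : Prop where
  reg : ∀ i, i ∉ P.collect Instr.wreg → s'.reg i = s.reg i
  arr : ∀ i, i ∉ P.collect Instr.warr → s'.arr i = s.arr i
  rreg : ∀ i, i ∉ P.collect Instr.wrreg → s'.rreg i = s.rreg i
  rarr : ∀ i, i ∉ P.collect Instr.wrarr → s'.rarr i = s.rarr i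

theorem Exec.frame {s' : State} {t : ℕ} (h : Exec P s t s') : Frame P s s' :=
  ⟨fun _ => h.reg_eq, fun _ => h.arr_eq, fun _ => h.rreg_eq, fun _ => h.rarr_eq⟩

theorem Runs.frame (h : Runs P s B Q) : Runs P s B fun s' => Q s' ∧ Frame P s s' := by
  obtain ⟨t, s', ht, he, hq⟩ := h
  exact ⟨t, s', ht, he, hq, he.frame⟩

/-! ### Counting loops -/

/-- Overwrite a word register. -/
def State.setReg (s : State) (i v : ℕ) : State := { s with reg := Function.update s.reg i v }

/-- `for i := 0 to reg b - 1 do P`, where the register `o` holds the number `1`. -/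
def forLoop (i b o : ℕ) (P : Prog) : Prog :=
  .seq (.instr (.const i 0)) (.loop (.lt i b) (.seq P (.instr (.add i i o))))

/-- Induction on the number of remaining rounds. A round costs the body, the increment and the test,
hence B + 2; the final 2 pays for the initialization and the failing test. By `hset` the invariant
ignores the counter, which changes outside the body. -/
theorem Runs.forLoop_of_reg {i b o N : ℕ} (Inv : ℕ → State → Prop)
    (hib : i ≠ b) (hio : i ≠ o)
    (hi : i ∉ P.collect Instr.wreg) (hb : b ∉ P.collect Instr.wreg)
    (ho : o ∉ P.collect Instr.wreg) (hsb : s.reg b = N) (hso : s.reg o = 1)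
    (h0 : Inv 0 (s.setReg i 0))
    (hset : ∀ k s' v, Inv k s' → Inv k (State.setReg s' i v))
    (hbody : ∀ k s', k < N → s'.reg i = k → s'.reg b = N → s'.reg o = 1 → Inv k s' →
      Runs P s' B (Inv (k + 1))) :
    Runs (forLoop i b o P) s (N * (B + 2) + 2) (Inv N) := by
  have key : ∀ d k s', k + d = N → s'.reg i = k → s'.reg b = N → s'.reg o = 1 → Inv k s' →
      Runs (.loop (.lt i b) (.seq P (.instr (.add i i o)))) s' (d * (B + 2) + 1) (Inv N) := by
    intro d
    induction d with
    | zero =>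
      intro k s' hk h₁ h₂ h₃ h₄
      refine ⟨1, s', by omega, .loop_false ?_, ?_⟩
      · simp [Test.Holds]; omega
      · rwa [← hk]
    | succ d ih =>
      intro k s' hk h₁ h₂ h₃ h₄
      obtain ⟨t, s₁, ht, he, hq⟩ := hbody k s' (by omega) h₁ h₂ h₃ h₄
      have e₁ := he.reg_eq hi
      have e₂ := he.reg_eq hb
      have e₃ := he.reg_eq ho
      obtain ⟨t', s₂, ht', he', hq'⟩ := ih (k + 1) (State.setReg s₁ i (k + 1)) (by omega)
        (by simp [State.setReg]) (by simp [State.setReg, hib.symm, e₂, h₂])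
        (by simp [State.setReg, hio.symm, e₃, h₃]) (hset _ _ _ hq)
      refine ⟨t + 1 + t' + 1, s₂, ?_, .loop_true ?_ (.seq he (.instr _ _)) ?_, hq'⟩
      · have : (d + 1) * (B + 2) = d * (B + 2) + (B + 2) := by ring
        omega
      · simp [Test.Holds]; omega
      · have : (Instr.add i i o).apply s₁ = State.setReg s₁ i (k + 1) := by
          simp [Instr.apply, State.setReg, e₁, h₁, e₃, h₃]
        rwa [this]
  refine (Runs.instr_seq (a := .const i 0) (s := s)
    (key N 0 (s.setReg i 0) (by omega) ?_ ?_ ?_ h0)).of_le (by omega)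
  · simp [State.setReg]
  · simp [State.setReg, hib.symm, hsb]
  · simp [State.setReg, hio.symm, hso]

/-- The rule for `forLoop`; the body may use that cells which the loop does not change are as they
were initially. -/
theorem Runs.forLoop {i b o N : ℕ} (Inv : ℕ → State → Prop)
    (hib : i ≠ b) (hio : i ≠ o)
    (hi : i ∉ P.collect Instr.wreg) (hb : b ∉ P.collect Instr.wreg)
    (ho : o ∉ P.collect Instr.wreg) (hsb : s.reg b = N) (hso : s.reg o = 1)
    (h0 : Inv 0 (s.setReg i 0))
    (hset : ∀ k s' v, Inv k s' → Inv k (State.setReg s' i v))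
    (hbody : ∀ k s', k < N → s'.reg i = k → Frame (forLoop i b o P) s s' → Inv k s' →
      Runs P s' B (Inv (k + 1))) :
    Runs (forLoop i b o P) s (N * (B + 2) + 2) (Inv N) := by
  have hfr : ∀ s' v, Frame (CableTrench.forLoop i b o P) s s' →
      Frame (CableTrench.forLoop i b o P) s (State.setReg s' i v) := by
    refine fun s' v h => ⟨fun j hj => ?_, h.arr, h.rreg, h.rarr⟩
    have hji : j ≠ i := by
      rintro rfl
      simp [CableTrench.forLoop, Prog.collect, Instr.wreg] at hj
    simp [State.setReg, hji, h.reg j hj]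
  refine (Runs.forLoop_of_reg (B := B)
    (fun k s' => Inv k s' ∧ Frame (CableTrench.forLoop i b o P) s s') hib hio hi hb ho hsb hso
    ⟨h0, hfr _ _ ⟨fun _ _ => rfl, fun _ _ => rfl, fun _ _ => rfl, fun _ _ => rfl⟩⟩
    (fun k s' v h => ⟨hset k s' v h.1, hfr s' v h.2⟩)
    fun k s' hk h₁ _ _ h => ?_).mono le_rfl fun _ => And.left
  refine (hbody k s' hk h₁ h.2 h.1).frame.mono le_rfl fun s'' h' => ⟨h'.1, ?_⟩
  have hc : ∀ f j, j ∉ (CableTrench.forLoop i b o P).collect f → j ∉ P.collect f := by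
    intro f j hj hjP
    simp [CableTrench.forLoop, Prog.collect, hjP] at hj
  exact ⟨fun j hj => (h'.2.reg j (hc _ j hj)).trans (h.2.reg j hj),
    fun j hj => (h'.2.arr j (hc _ j hj)).trans (h.2.arr j hj),
    fun j hj => (h'.2.rreg j (hc _ j hj)).trans (h.2.rreg j hj),
    fun j hj => (h'.2.rarr j (hc _ j hj)).trans (h.2.rarr j hj)⟩

/-- Execute `P` if the registers `i` and `j` differ. -/
def ifNe (i j : ℕ) (P : Prog) : Prog :=
  .ite (.lt i j) P (.ite (.lt j i) P (.instr .skip))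

theorem Runs.ifNe {i j : ℕ} (hB : 1 ≤ B) (h₁ : s.reg i ≠ s.reg j → Runs P s B Q)
    (h₂ : s.reg i = s.reg j → Q s) : Runs (ifNe i j P) s (B + 2) Q := by
  refine Runs.ite (fun h => (h₁ ?_).of_le (by omega)) fun h => Runs.ite (fun h' => h₁ ?_) fun h' =>
    (Runs.instr (h₂ ?_)).of_le hB
  all_goals simp only [Test.Holds] at *; omega

end Machine

/-! ### Counting unreachable vertices -/

section Count

open SimpleGraph

/-- The part of the input that is never changed, together with the constants `0` and `1`. -/
structure Env {n m : ℕ} {G : SimpleGraph (Fin n)} (L : EdgeListing G m) (γ τ : Sym2 (Fin n) → ℝ)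
    (r : Fin n) (s : State) : Prop where
  vertices : s.reg 0 = n
  edges : s.reg 1 = m
  root : s.reg 3 = r
  one : s.reg 9 = 1
  zero : s.reg 10 = 0
  src : ∀ k : Fin m, s.arr 0 k = L.src k
  tgt : ∀ k : Fin m, s.arr 1 k = L.tgt k
  cable : ∀ k : Fin m, s.rarr 0 k = γ (L.edge k)
  trench : ∀ k : Fin m, s.rarr 1 k = τ (L.edge k)

/-- The program leaves the cells described by `Env` alone. -/
abbrev Prog.Safe (P : Prog) : Prop :=
  (∀ i ∈ [0, 1, 3, 9, 10], i ∉ P.collect Instr.wreg) ∧ (∀ i ∈ [0, 1], i ∉ P.collect Instr.warr) ∧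
    ∀ i ∈ [0, 1], i ∉ P.collect Instr.wrarr

variable {n m : ℕ} {G : SimpleGraph (Fin n)} {L : EdgeListing G m} {γ τ : Sym2 (Fin n) → ℝ}
  {r : Fin n} {s s' : State}

theorem Env.frame (h : Env L γ τ r s) {P : Prog} (hP : P.Safe) (hf : Frame P s s') :
    Env L γ τ r s' where
  vertices := (hf.reg 0 (hP.1 _ (by simp))).trans h.vertices
  edges := (hf.reg 1 (hP.1 _ (by simp))).trans h.edges
  root := (hf.reg 3 (hP.1 _ (by simp))).trans h.root
  one := (hf.reg 9 (hP.1 _ (by simp))).trans h.one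
  zero := (hf.reg 10 (hP.1 _ (by simp))).trans h.zero
  src k := by rw [hf.arr 0 (hP.2.1 _ (by simp)), h.src]
  tgt k := by rw [hf.arr 1 (hP.2.1 _ (by simp)), h.tgt]
  cable k := by rw [hf.rarr 0 (hP.2.2 _ (by simp)), h.cable]
  trench k := by rw [hf.rarr 1 (hP.2.2 _ (by simp)), h.trench]

theorem Env.instr (h : Env L γ τ r s) {a : Instr} (ha : (Prog.instr a).Safe) :
    Env L γ τ r (a.apply s) :=
  h.frame ha (Exec.instr a s).frame

theorem EdgeListing.edge_injective (L : EdgeListing G m) : Function.Injective L.edge := L.injective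

theorem EdgeListing.exists_edge_eq (L : EdgeListing G m) {e : Sym2 (Fin n)} (he : e ∈ G.edgeSet) :
    ∃ k, L.edge k = e := by
  rw [← L.range_eq] at he
  exact he

/-- Mark both ends of the edge with number `reg 12` if one of them is marked, unless the edge is one
of the two that are removed. -/
def relaxProg : Prog :=
  ifNe 12 4 <| ifNe 12 5 <|
    .seq (.instr (.load 13 0 12)) <| .seq (.instr (.load 14 1 12)) <|
    .seq (.instr (.load 15 4 13)) <| .seq (.instr (.load 16 4 14)) <|
    .seq (.instr (.add 15 15 16)) <|
    .ite (.lt 10 15) (.seq (.instr (.store 4 13 9)) (.instr (.store 4 14 9))) (.instr .skip)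

/-- The three clauses are monotonicity, soundness and completeness of the marks for a single edge,
in the form that composes along a round. -/
theorem runs_relaxProg (h : Env L γ τ r s) {p q k : Fin m} (hp : s.reg 4 = p) (hq : s.reg 5 = q)
    (hk : s.reg 12 = k) :
    Runs relaxProg s 12 fun s' =>
      (∀ w, s.arr 4 w ≠ 0 → s'.arr 4 w ≠ 0) ∧
      (∀ w : Fin n, s'.arr 4 w ≠ 0 → s.arr 4 w ≠ 0 ∨
        ∃ u : Fin n, s.arr 4 u ≠ 0 ∧ (G.deleteEdges {L.edge p, L.edge q}).Adj u w) ∧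
      (k ≠ p → k ≠ q → s.arr 4 (L.src k) ≠ 0 ∨ s.arr 4 (L.tgt k) ≠ 0 →
        s'.arr 4 (L.src k) ≠ 0 ∧ s'.arr 4 (L.tgt k) ≠ 0) := by
  refine Runs.ifNe (B := 10) (by norm_num) (fun h₁ => Runs.ifNe (B := 8) (by norm_num)
    (fun h₂ => ?_) ?_) ?_
  · have hadj : (G.deleteEdges {L.edge p, L.edge q}).Adj (L.src k) (L.tgt k) := by
      rw [deleteEdges_adj]
      refine ⟨L.edge_mem k, ?_⟩
      rintro (he | he)
      · exact h₁ (by rw [hk, hp, L.edge_injective (show L.edge k = L.edge p from he)])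
      · exact h₂ (by rw [hk, hq, L.edge_injective (show L.edge k = L.edge q from he)])
    refine Runs.instr_seq <| Runs.instr_seq <| Runs.instr_seq <| Runs.instr_seq <|
      Runs.instr_seq <| Runs.ite (B := 2) (fun hb => ?_) fun hb => ?_
    · refine Runs.instr_seq <| Runs.instr ?_
      simp only [Test.Holds, Instr.apply] at hb
      simp [hk, h.src, h.tgt, h.zero] at hb
      simp [-deleteEdges_adj, Instr.apply, hk, h.src, h.tgt, h.one]
      refine ⟨fun w hw => ?_, fun w hw => ?_, ?_⟩
      · by_cases h₁ : w = L.tgt k <;> by_cases h₂ : w = L.src k <;>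
          simp [Function.update_apply, h₁, h₂, hw]
      · by_cases ht : w = L.tgt k
        · subst ht
          by_cases h0 : s.arr 4 (L.tgt k) = 0
          · exact Or.inr ⟨L.src k, by omega, hadj⟩
          · exact Or.inl h0
        · by_cases hs : w = L.src k
          · subst hs
            by_cases h0 : s.arr 4 (L.src k) = 0
            · exact Or.inr ⟨L.tgt k, by omega, hadj.symm⟩
            · exact Or.inl h0
          · left
            have e₁ : (w : ℕ) ≠ L.tgt k := fun h => ht (Fin.ext h)
            have e₂ : (w : ℕ) ≠ L.src k := fun h => hs (Fin.ext h)
            simpa [Function.update_apply, e₁, e₂] using hw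
      · intro _ _ _
        simp [Function.update_apply]
    · refine (Runs.instr ?_).of_le one_le_two
      simp only [Test.Holds, Instr.apply] at hb
      simp [hk, h.src, h.tgt, h.zero] at hb
      simp [Instr.apply, hb]
      exact fun w hw => Or.inl hw
  · intro he
    rw [hk, hq] at he
    exact ⟨fun _ => id, fun _ => Or.inl, fun _ h => absurd (Fin.ext he) h⟩
  · intro he
    rw [hk, hp] at he
    exact ⟨fun _ => id, fun _ => Or.inl, fun h => absurd (Fin.ext he) h⟩

/-- Relax all the edges once. -/
def roundProg : Prog := forLoop 12 1 9 relaxProg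

/-- Marks are updated in place and may travel along several edges in one round. Soundness is
therefore expressed by reachability, and completeness only promises progress by one edge. -/
theorem runs_roundProg (h : Env L γ τ r s) {p q : Fin m} (hp : s.reg 4 = p) (hq : s.reg 5 = q)
    (hsound : ∀ w : Fin n, s.arr 4 w ≠ 0 →
      (G.deleteEdges {L.edge p, L.edge q}).Reachable w r) :
    Runs roundProg s (m * 14 + 2) fun s' =>
      (∀ w, s.arr 4 w ≠ 0 → s'.arr 4 w ≠ 0) ∧
      (∀ w : Fin n, s'.arr 4 w ≠ 0 →
        (G.deleteEdges {L.edge p, L.edge q}).Reachable w r) ∧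
      ∀ u w : Fin n, s.arr 4 u ≠ 0 → (G.deleteEdges {L.edge p, L.edge q}).Adj w u →
        s'.arr 4 w ≠ 0 := by
  refine (Runs.forLoop (B := 12) (N := m) (fun k s' => (∀ w, s.arr 4 w ≠ 0 → s'.arr 4 w ≠ 0) ∧
      (∀ w : Fin n, s'.arr 4 w ≠ 0 → (G.deleteEdges {L.edge p, L.edge q}).Reachable w r) ∧
      ∀ j : Fin m, j < k → j ≠ p → j ≠ q → s.arr 4 (L.src j) ≠ 0 ∨ s.arr 4 (L.tgt j) ≠ 0 →
        s'.arr 4 (L.src j) ≠ 0 ∧ s'.arr 4 (L.tgt j) ≠ 0)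
    (by decide) (by decide) (by decide) (by decide) (by decide) h.edges h.one
    ⟨fun _ => id, hsound, fun _ h => absurd h (by simp)⟩
    (fun _ _ _ h => h) ?_).mono le_rfl ?_
  · rintro k s₁ hk hk' hf ⟨i₁, i₂, i₃⟩
    refine (runs_relaxProg (k := ⟨k, hk⟩) (h.frame (by decide) hf)
      ((hf.reg 4 (by decide)).trans hp) ((hf.reg 5 (by decide)).trans hq) hk').mono le_rfl ?_
    rintro s₂ ⟨j₁, j₂, j₃⟩
    refine ⟨fun w hw => j₁ w (i₁ w hw), fun w hw => ?_, fun j hj hjp hjq ho => ?_⟩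
    · rcases j₂ w hw with hw | ⟨u, hu, hadj⟩
      · exact i₂ w hw
      · exact hadj.symm.reachable.trans (i₂ u hu)
    · rcases Nat.lt_succ_iff_lt_or_eq.1 hj with hj | hj
      · exact (i₃ j hj hjp hjq ho).imp (j₁ _) (j₁ _)
      · obtain rfl : j = ⟨k, hk⟩ := Fin.ext hj
        exact j₃ hjp hjq (ho.imp (i₁ _) (i₁ _))
  · rintro s₁ ⟨i₁, i₂, i₃⟩
    refine ⟨i₁, i₂, fun u w hu hadj => ?_⟩
    rw [deleteEdges_adj] at hadj
    obtain ⟨j, hj⟩ := L.exists_edge_eq (e := s(w, u)) hadj.1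
    have hjp : j ≠ p := fun h => hadj.2 (by simp [← hj, h])
    have hjq : j ≠ q := fun h => hadj.2 (by simp [← hj, h])
    have h₃ := i₃ j j.2 hjp hjq
    rcases Sym2.eq_iff.1 hj with ⟨e₁, e₂⟩ | ⟨e₁, e₂⟩
    · rw [e₁, e₂] at h₃
      exact (h₃ (Or.inr hu)).1
    · rw [e₁, e₂] at h₃
      exact (h₃ (Or.inl hu)).2

/-- Mark the vertices that are reachable from the root without the edges with the numbers `reg 4`
and `reg 5`. -/
def searchProg : Prog :=
  .seq (forLoop 17 0 9 (.instr (.store 4 17 10))) <| .seq (.instr (.store 4 3 9)) <|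
    forLoop 11 0 9 roundProg

/-- After k rounds every vertex with a walk of length at most k to the root is marked. Paths have
fewer than n edges, so n rounds suffice. -/
theorem runs_searchProg (h : Env L γ τ r s) {p q : Fin m} (hp : s.reg 4 = p) (hq : s.reg 5 = q) :
    Runs searchProg s (n * 3 + 2 + (n * (m * 14 + 4) + 3)) fun s' =>
      ∀ w : Fin n, s'.arr 4 w ≠ 0 ↔ (G.deleteEdges {L.edge p, L.edge q}).Reachable w r := by
  -- The marks must be cleared first, since an earlier search may have left some.
  refine Runs.seq ((Runs.forLoop (B := 1) (N := n) (fun k s' => ∀ w < k, s'.arr 4 w = 0)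
    (by decide) (by decide) (by decide) (by decide) (by decide) h.vertices h.one
    (by simp) (fun _ _ _ h => h) ?_).frame.mono le_rfl ?_)
  · intro k s₁ hk hk' hf hi
    refine Runs.instr fun w hw => ?_
    simp only [Instr.apply, Function.update_self, hk', hf.reg 10 (by decide), h.zero]
    by_cases hwk : w = k
    · simp [hwk]
    · simp [hwk, hi w (by omega)]
  rintro s₁ ⟨h₁, hf₁⟩
  have e₁ := h.frame (by decide) hf₁
  refine Runs.instr_seq ?_
  have e₂ := e₁.instr (a := .store 4 3 9) (by decide)
  have hvis : ∀ w : Fin n, (Instr.apply (.store 4 3 9) s₁).arr 4 w ≠ 0 ↔ w = r := by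
    intro w
    simp only [Instr.apply, Function.update_self, e₁.root, e₁.one]
    by_cases hw : w = r
    · simp [hw]
    · have : (w : ℕ) ≠ r := fun h => hw (Fin.ext h)
      simp [this, hw, h₁ w w.2]
  have hp₂ : (Instr.apply (.store 4 3 9) s₁).reg 4 = p := (hf₁.reg 4 (by decide)).trans hp
  have hq₂ : (Instr.apply (.store 4 3 9) s₁).reg 5 = q := (hf₁.reg 5 (by decide)).trans hq
  generalize Instr.apply (.store 4 3 9) s₁ = s₂ at e₂ hvis hp₂ hq₂
  refine (Runs.forLoop (B := m * 14 + 2) (N := n) (fun k s' =>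
      (∀ w : Fin n, s'.arr 4 w ≠ 0 → (G.deleteEdges {L.edge p, L.edge q}).Reachable w r) ∧
      ∀ (w : Fin n) (x : (G.deleteEdges {L.edge p, L.edge q}).Walk w r), x.length ≤ k →
        s'.arr 4 w ≠ 0)
    (by decide) (by decide) (by decide) (by decide) (by decide) e₂.vertices e₂.one
    ⟨fun w hw => ?_, fun w x hx => ?_⟩ (fun _ _ _ h => h) ?_).mono le_rfl ?_
  · rw [(hvis w).1 hw]
  · exact (hvis w).2 (Walk.eq_of_length_eq_zero (Nat.le_zero.1 hx))
  · rintro k s₃ hk hk' hf ⟨i₁, i₂⟩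
    refine (runs_roundProg (e₂.frame (by decide) hf) ((hf.reg 4 (by decide)).trans hp₂)
      ((hf.reg 5 (by decide)).trans hq₂) i₁).mono le_rfl ?_
    rintro s₄ ⟨j₁, j₂, j₃⟩
    refine ⟨j₂, fun w x hx => ?_⟩
    cases x with
    | nil => exact j₁ _ (i₂ _ Walk.nil (by simp))
    | cons hadj y => exact j₃ _ _ (i₂ _ y (by simpa using hx)) hadj
  · rintro s₃ ⟨i₁, i₂⟩ w
    refine ⟨i₁ w, fun hr => ?_⟩
    obtain ⟨x, hx⟩ := hr.exists_isPath
    have := hx.length_lt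
    rw [Fintype.card_fin] at this
    exact i₂ w x this.le

/-- Store in `reg 6` the number of the vertices that are not reachable from the root without the
edges with the numbers `reg 4` and `reg 5`. -/
def countProg : Prog :=
  .seq searchProg <| .seq (.instr (.const 6 0)) <| forLoop 17 0 9 <|
    .seq (.instr (.load 15 4 17)) <| .ite (.lt 10 15) (.instr .skip) (.instr (.add 6 6 9))

/-- A bound for the running time of `countProg`. -/
def countTime (n m : ℕ) : ℕ := n * 3 + 2 + (n * (m * 14 + 4) + 3) + (n * 5 + 3)

theorem runs_countProg (h : Env L γ τ r s) {p q : Fin m} (hp : s.reg 4 = p) (hq : s.reg 5 = q) :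
    Runs countProg s (countTime n m) fun s' =>
      s'.reg 6 = cut G r (L.edge p) (L.edge q) ∧ Frame countProg s s' := by
  refine Runs.frame ?_
  refine Runs.seq ((runs_searchProg h hp hq).frame.mono le_rfl ?_)
  rintro s₁ ⟨h₁, hf₁⟩
  have e₁ := h.frame (by decide) hf₁
  refine Runs.instr_seq ?_
  have e₂ := e₁.instr (a := .const 6 0) (by decide)
  have h6 : (Instr.apply (.const 6 0) s₁).reg 6 = 0 := by simp [Instr.apply]
  have h₂ : ∀ w : Fin n, (Instr.apply (.const 6 0) s₁).arr 4 w ≠ 0 ↔ _ := h₁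
  generalize Instr.apply (.const 6 0) s₁ = s₂ at e₂ h₂ h6
  refine (Runs.forLoop (B := 3) (N := n) (fun k s' => s'.reg 6 =
      ∑ w ∈ Finset.range k, if s₂.arr 4 w = 0 then 1 else 0)
    (by decide) (by decide) (by decide) (by decide) (by decide) e₂.vertices e₂.one
    (by simp [State.setReg, h6]) (fun k s' v h => by simpa [State.setReg] using h) ?_).mono
    (by omega) ?_
  · intro k s₃ hk hk' hf hi
    have e₃ := e₂.frame (by decide) hf
    refine Runs.instr_seq <| Runs.ite (B := 1) (fun hb => Runs.instr ?_) fun hb => Runs.instr ?_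
    all_goals
      simp [Test.Holds, Instr.apply, hk', hf.arr 4 (by decide), e₃.zero] at hb
      rw [Finset.sum_range_succ, ← hi]
    · simp [Instr.apply]
      omega
    · simp [Instr.apply, hb, e₃.one]
  · intro s₃ h₃
    rw [h₃, cut, unreached, Finset.card_filter, Finset.sum_range]
    refine Finset.sum_congr rfl fun w _ => ?_
    have := h₂ w
    by_cases hw : s₂.arr 4 w = 0
    · rw [if_pos hw, if_pos]
      exact fun h => this.2 h.symm hw
    · rw [if_neg hw, if_neg]
      exact not_not.2 (this.1 hw).symm

end Count

/-! ### The algorithm -/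

section Algorithm

open SimpleGraph

variable {n m : ℕ} {G : SimpleGraph (Fin n)} {L : EdgeListing G m} {γ τ : Sym2 (Fin n) → ℝ}
  {r : Fin n} {s : State}

/-- Copy `reg i` and `reg j` to `reg 4` and `reg 5`, and count the vertices that are not reachable
from the root without the edges with these numbers. -/
def cutProg (i j : ℕ) : Prog :=
  .seq (.instr (.add 4 i 10)) <| .seq (.instr (.add 5 j 10)) countProg

/-- Adding register 10, which holds 0, copies a register. The first copy overwrites register 4,
hence `j ≠ 4`. -/
theorem runs_cutProg (h : Env L γ τ r s) {i j : ℕ} (hj : j ≠ 4) {p q : Fin m} (hp : s.reg i = p)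
    (hq : s.reg j = q) :
    Runs (cutProg i j) s (countTime n m + 2) fun s' =>
      s'.reg 6 = cut G r (L.edge p) (L.edge q) ∧ Frame (cutProg i j) s s' := by
  have h₁ : (Prog.instr (.add 4 i 10)).Safe := by
    simp [Prog.Safe, Prog.collect, Instr.wreg, Instr.warr, Instr.wrarr]
  have h₂ : (Prog.instr (.add 5 j 10)).Safe := by
    simp [Prog.Safe, Prog.collect, Instr.wreg, Instr.warr, Instr.wrarr]
  refine Runs.frame <| Runs.instr_seq <| Runs.instr_seq <|
    (runs_countProg ((h.instr h₁).instr h₂) ?_ ?_).mono le_rfl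
      fun _ => And.left
  · simp [Instr.apply, hp, h.zero]
  · simp [Instr.apply, hj, hq, h.zero]

/-- Add to the real register `0` the cable cost of the edge `reg 8` for each vertex that is
separated from the root by the removal of the edges `reg 7` and `reg 8`. -/
def addCutProg : Prog :=
  .seq (cutProg 7 8) <| .seq (.instr (.rload 1 0 8)) <| forLoop 20 6 9 (.instr (.radd 0 0 1))

theorem unreached_le {V : Type*} [Fintype V] (H : SimpleGraph V) (r : V) :
    unreached H r ≤ Fintype.card V := by
  classical
  exact Finset.card_le_univ _

/-- The machine has no multiplication, so the product is formed by repeated addition, with at most n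
rounds because a cut counts vertices. -/
theorem runs_addCutProg (h : Env L γ τ r s) {e f : Fin m} (he : s.reg 7 = e) (hf : s.reg 8 = f) :
    Runs addCutProg s (countTime n m + 2 + (n * 3 + 3)) fun s' =>
      s'.rreg 0 = s.rreg 0 + γ (L.edge f) * cut G r (L.edge e) (L.edge f) := by
  refine Runs.seq ((runs_cutProg h (by decide) he hf).mono le_rfl ?_)
  rintro s₁ ⟨h₁, hf₁⟩
  have e₁ := h.frame (by decide) hf₁
  have h8 := (hf₁.reg 8 (by decide)).trans hf
  have h0 := hf₁.rreg 0 (by decide)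
  refine Runs.instr_seq ?_
  have e₂ := e₁.instr (a := .rload 1 0 8) (by decide)
  have hr₁ : (Instr.apply (.rload 1 0 8) s₁).rreg 1 = γ (L.edge f) := by
    simp [Instr.apply, h8, e₁.cable]
  have hr₀ : (Instr.apply (.rload 1 0 8) s₁).rreg 0 = s.rreg 0 := by
    simp [Instr.apply, h0]
  have h6 : (Instr.apply (.rload 1 0 8) s₁).reg 6 = _ := h₁
  generalize Instr.apply (.rload 1 0 8) s₁ = s₂ at e₂ hr₁ hr₀ h6
  refine (Runs.forLoop (B := 1) (fun k s' => s'.rreg 0 = s.rreg 0 + γ (L.edge f) * k)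
    (by decide) (by decide) (by decide) (by decide) (by decide) h6 e₂.one
    (by simp [State.setReg, hr₀]) (fun k s' v h => h) ?_).mono ?_ fun _ => id
  · intro k s₃ hk hk' hf hi
    refine Runs.instr ?_
    simp only [Instr.apply, Function.update_self, hi, hf.rreg 1 (by decide), hr₁]
    push_cast
    ring
  · have : cut G r (L.edge e) (L.edge f) ≤ n := (unreached_le _ r).trans (by simp)
    omega

/-- Compute the penalty of the edge `reg 7`. -/
def penaltyProg : Prog :=
  .seq (.instr (.rzero 0)) <| .seq (forLoop 8 1 9 addCutProg) <|
    .seq (.instr (.rload 2 1 7)) <| .seq (.instr (.rsub 0 0 2)) <| .instr (.rstore 2 7 0)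

theorem EdgeListing.penalty_eq (L : EdgeListing G m) (γ τ : Sym2 (Fin n) → ℝ) (r : Fin n)
    (e : Sym2 (Fin n)) :
    penalty G γ τ r e = ∑ k : Fin m, γ (L.edge k) * cut G r e (L.edge k) - τ e := by
  classical
  rw [penalty]
  congr 1
  have : G.edgeFinset = Finset.univ.image L.edge := by
    ext x
    simp only [mem_edgeFinset, Finset.mem_image, Finset.mem_univ, true_and]
    exact ⟨L.exists_edge_eq, fun ⟨k, hk⟩ => hk ▸ L.edge_mem k⟩
  rw [← Finset.sum_image (f := fun x => γ x * cut G r e x) (L.edge_injective.injOn)]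
  exact Finset.sum_congr (by convert this) fun _ _ => rfl

/-- A bound for the running time of `penaltyProg`. -/
def penaltyTime (n m : ℕ) : ℕ := m * (countTime n m + 2 + (n * 3 + 3) + 2) + 6

theorem runs_penaltyProg (h : Env L γ τ r s) {e : Fin m} (he : s.reg 7 = e) :
    Runs penaltyProg s (penaltyTime n m) fun s' =>
      s'.rarr 2 = Function.update (s.rarr 2) e (penalty G γ τ r (L.edge e)) := by
  have e₁ := h.instr (a := .rzero 0) (by decide)
  have h7 : (Instr.apply (.rzero 0) s).reg 7 = e := he
  have h0 : (Instr.apply (.rzero 0) s).rreg 0 = 0 := by simp [Instr.apply]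
  have h2 : (Instr.apply (.rzero 0) s).rarr 2 = s.rarr 2 := rfl
  refine Runs.instr_seq (B := _ + 2 + 3) ?_
  generalize Instr.apply (.rzero 0) s = s₁ at e₁ h7 h0 h2
  refine Runs.seq ((Runs.forLoop (B := countTime n m + 2 + (n * 3 + 3)) (N := m)
    (fun k s' => s'.rreg 0 = ∑ f ∈ Finset.range k, if hf : f < m then
      γ (L.edge ⟨f, hf⟩) * cut G r (L.edge e) (L.edge ⟨f, hf⟩) else 0)
    (by decide) (by decide) (by decide) (by decide) (by decide) e₁.edges e₁.one
    (by simp [State.setReg, h0]) (fun k s' v h => h) ?_).frame.mono le_rfl ?_)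
  · intro k s₂ hk hk' hf hi
    refine (runs_addCutProg (e := e) (f := ⟨k, hk⟩) (e₁.frame (by decide) hf)
      ((hf.reg 7 (by decide)).trans h7) hk').mono le_rfl fun s₃ h₃ => ?_
    rw [h₃, hi, Finset.sum_range_succ, dif_pos hk]
  · rintro s₂ ⟨h₂, hf⟩
    have e₂ := e₁.frame (by decide) hf
    refine Runs.instr_seq <| Runs.instr_seq <| Runs.instr ?_
    have h7₂ := (hf.reg 7 (by decide)).trans h7
    simp only [Instr.apply, Function.update_self, h7₂, hf.rarr 2 (by decide), h2]
    congr 1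
    rw [L.penalty_eq, Function.update_of_ne (by decide), h₂, e₂.trench, Finset.sum_range]
    simp

/-! ### Deciding which edges to omit -/

/-- Set `reg 18` to `1` if the edge `reg 8` rules out the omission of the edge `reg 7`, whose
penalty is in the real register `0`. -/
def compareProg : Prog :=
  .seq (cutProg 7 8) <| .ite (.lt 10 6)
    (.seq (cutProg 8 8) <| .ite (.lt 10 6) (.instr .skip) <|
      .seq (.instr (.rload 1 2 8)) <| .ite (.rlt 1 0) (.instr (.const 18 1)) <|
        .ite (.rlt 0 1) (.instr .skip) <|
          .ite (.lt 8 7) (.instr (.const 18 1)) (.instr .skip))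
    (.instr .skip)

/-- The numbering of the edges by the listing. -/
noncomputable def EdgeListing.index (L : EdgeListing G m) : Sym2 (Fin n) → ℕ :=
  Function.extend L.edge Fin.val 0

theorem EdgeListing.index_edge (L : EdgeListing G m) (k : Fin m) : L.index (L.edge k) = k :=
  L.edge_injective.extend_apply _ _ _

theorem EdgeListing.injOn_index (L : EdgeListing G m) : Set.InjOn L.index G.edgeSet := by
  intro e he f hf h
  obtain ⟨j, rfl⟩ := L.exists_edge_eq he
  obtain ⟨k, rfl⟩ := L.exists_edge_eq hf
  rw [L.index_edge, L.index_edge] at h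
  rw [Fin.ext h]

/-- `f` lies on a cycle with `e` and is a better candidate for omission. -/
def RulesOut (L : EdgeListing G m) (γ τ : Sym2 (Fin n) → ℝ) (r : Fin n) (f e : Fin m) : Prop :=
  cut G r (L.edge f) (L.edge f) = 0 ∧ cut G r (L.edge e) (L.edge f) ≠ 0 ∧
    Better (penalty G γ τ r) L.index (L.edge f) (L.edge e)

/-- The nested tests follow `RulesOut`. Equality of penalties cannot be tested directly and is
detected by the failure of both strict comparisons. -/
theorem runs_compareProg (h : Env L γ τ r s) {e f : Fin m} (he : s.reg 7 = e) (hf : s.reg 8 = f)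
    (hpe : s.rreg 0 = penalty G γ τ r (L.edge e))
    (hpf : s.rarr 2 f = penalty G γ τ r (L.edge f)) :
    Runs compareProg s (2 * countTime n m + 11) fun s' =>
      s'.reg 18 = 1 ↔ s.reg 18 = 1 ∨ RulesOut L γ τ r f e := by
  refine (Runs.seq (B' := countTime n m + 9)
    ((runs_cutProg h (by decide) he hf).mono le_rfl ?_)).of_le (by omega)
  rintro s₁ ⟨h₁, hf₁⟩
  have e₁ := h.frame (by decide) hf₁
  have h18 := hf₁.reg 18 (by decide)
  refine Runs.ite (B := countTime n m + 8) (fun hb => ?_) fun hb =>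
    (Runs.instr ?_).of_le (by omega)
  · simp only [Test.Holds, e₁.zero, h₁] at hb
    have h7 := (hf₁.reg 7 (by decide)).trans he
    have h8 := (hf₁.reg 8 (by decide)).trans hf
    refine (Runs.seq (B' := 6)
      ((runs_cutProg e₁ (by decide) h8 h8).mono le_rfl ?_)).of_le (by omega)
    rintro s₂ ⟨h₂, hf₂⟩
    have e₂ := e₁.frame (by decide) hf₂
    have h18' := (hf₂.reg 18 (by decide)).trans h18
    have h7' := (hf₂.reg 7 (by decide)).trans h7
    have h8' := (hf₂.reg 8 (by decide)).trans h8
    have hr0 : s₂.rreg 0 = _ :=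
      ((hf₂.rreg 0 (by decide)).trans (hf₁.rreg 0 (by decide))).trans hpe
    have hr2 : s₂.rarr 2 f = _ :=
      (congrFun ((hf₂.rarr 2 (by decide)).trans (hf₁.rarr 2 (by decide))) f).trans hpf
    refine Runs.ite (B := 5) (fun hc => (Runs.instr ?_).of_le (by omega)) fun hc => ?_
    · simp only [Test.Holds, e₂.zero, h₂] at hc
      simp [Instr.apply, h18', RulesOut, hc.ne']
    · simp only [Test.Holds, e₂.zero, h₂, not_lt, Nat.le_zero] at hc
      refine Runs.instr_seq <| Runs.ite (B := 3) (fun hd => (Runs.instr ?_).of_le (by omega))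
        fun hd => Runs.ite (B := 2) (fun hd' => (Runs.instr ?_).of_le (by omega)) fun hd' =>
        Runs.ite (B := 1) (fun hl => Runs.instr ?_) fun hl => Runs.instr ?_
      all_goals
        simp [Test.Holds, Instr.apply, h8', hr0, hr2] at hd
        try simp [Test.Holds, Instr.apply, h8', hr0, hr2] at hd'
        try simp [Test.Holds, Instr.apply, h8', h7'] at hl
        simp [Instr.apply, h18', RulesOut, hc, hb.ne', Better, L.index_edge]
      · exact Or.inr (Or.inl hd)
      · intro hg
        exfalso
        rcases hg with hg | hg
        · exact absurd hg (not_lt.2 hd)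
        · exact absurd hd' (not_lt.2 hg.1)
      · exact Or.inr (Or.inr ⟨hd', hl⟩)
      · intro hg
        exfalso
        rcases hg with hg | hg
        · exact absurd hg (not_lt.2 hd)
        · exact absurd hg.2 (not_lt.2 hl)
  · simp only [Test.Holds, e₁.zero, h₁, not_lt, Nat.le_zero] at hb
    simp [Instr.apply, h18, RulesOut, hb]

/-- This disjunction is what register 18 accumulates: it starts with the bridge test and is set to 1
as soon as some edge rules out e. -/
theorem EdgeListing.mem_omitted_iff (L : EdgeListing G m) (e : Fin m) :
    L.edge e ∈ omitted G γ τ r L.index ↔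
      ¬ (cut G r (L.edge e) (L.edge e) ≠ 0 ∨ ∃ f : Fin m, RulesOut L γ τ r f e) := by
  simp only [omitted, Set.mem_ofPred_eq, L.edge_mem, true_and, RulesOut, not_or, not_not,
    not_exists, not_and]
  refine and_congr_right fun _ => ⟨fun h f => h _ (L.edge_mem f), fun h x hx => ?_⟩
  obtain ⟨f, rfl⟩ := L.exists_edge_eq hx
  exact h f

/-- Decide whether the edge `reg 7`, whose penalty is in the real register `0`, belongs to the tree,
where `reg 18` tells whether it is a bridge. -/
def compareAllProg : Prog := .seq (forLoop 8 1 9 compareProg) (.instr (.store 3 7 18))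

/-- The last clause ensures that decisions already made for other edges survive. -/
theorem runs_compareAllProg (h : Env L γ τ r s) {e : Fin m} (he : s.reg 7 = e)
    (hr : s.rreg 0 = penalty G γ τ r (L.edge e))
    (hpen : ∀ k : Fin m, s.rarr 2 k = penalty G γ τ r (L.edge k))
    (h18 : s.reg 18 = 1 ↔ cut G r (L.edge e) (L.edge e) ≠ 0) :
    Runs compareAllProg s (m * (2 * countTime n m + 13) + 2 + 1) fun s' =>
      (s'.arr 3 e = 1 ↔ L.edge e ∉ omitted G γ τ r L.index) ∧
      ∀ k : Fin m, k ≠ e → s'.arr 3 k = s.arr 3 k := by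
  refine Runs.seq ((Runs.forLoop (B := 2 * countTime n m + 11) (N := m)
    (fun k s' => s'.reg 18 = 1 ↔ cut G r (L.edge e) (L.edge e) ≠ 0 ∨
      ∃ f : Fin m, f < k ∧ RulesOut L γ τ r f e)
    (by decide) (by decide) (by decide) (by decide) (by decide) h.edges h.one
    (by simpa [State.setReg] using h18) (fun k s' v h => by simpa [State.setReg] using h)
    ?_).frame.mono le_rfl ?_)
  · intro k s₅ hk hk' hf hi
    refine (runs_compareProg (e := e) (f := ⟨k, hk⟩) (h.frame (by decide) hf)
      ((hf.reg 7 (by decide)).trans he) hk' ((hf.rreg 0 (by decide)).trans hr)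
      ((congrFun (hf.rarr 2 (by decide)) k).trans (hpen ⟨k, hk⟩))).mono le_rfl fun s₆ h₆ => ?_
    rw [h₆, hi, or_assoc]
    refine or_congr_right ⟨?_, ?_⟩
    · rintro (⟨f, hfk, hR⟩ | hR)
      · exact ⟨f, hfk.trans (Nat.lt_succ_self k), hR⟩
      · exact ⟨⟨k, hk⟩, Nat.lt_succ_self k, hR⟩
    · rintro ⟨f, hfk, hR⟩
      rcases Nat.lt_succ_iff_lt_or_eq.1 hfk with hfk | hfk
      · exact Or.inl ⟨f, hfk, hR⟩
      · obtain rfl : f = ⟨k, hk⟩ := Fin.ext hfk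
        exact Or.inr hR
  · rintro s₅ ⟨h₅, hf⟩
    refine Runs.instr ?_
    have h7₅ := (hf.reg 7 (by decide)).trans he
    have h3₅ := hf.arr 3 (by decide)
    simp only [Instr.apply, Function.update_self, h7₅, h3₅]
    refine ⟨?_, fun k hk => ?_⟩
    · rw [h₅, L.mem_omitted_iff, not_not]
      simp
    · rw [Function.update_of_ne fun h => hk (Fin.ext h)]

/-- Decide whether the edge `reg 7` belongs to the tree. -/
def decideProg : Prog :=
  .seq (.instr (.const 18 0)) <| .seq (cutProg 7 7) <|
    .seq (.ite (.lt 10 6) (.instr (.const 18 1)) (.instr .skip)) <|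
      .seq (.instr (.rload 0 2 7)) compareAllProg

/-- A bound for the running time of `decideProg`. -/
def decideTime (n m : ℕ) : ℕ := countTime n m + m * (2 * countTime n m + 13) + 9

theorem runs_decideProg (h : Env L γ τ r s) {e : Fin m} (he : s.reg 7 = e)
    (hpen : ∀ k : Fin m, s.rarr 2 k = penalty G γ τ r (L.edge k)) :
    Runs decideProg s (decideTime n m) fun s' =>
      (s'.arr 3 e = 1 ↔ L.edge e ∉ omitted G γ τ r L.index) ∧
      ∀ k : Fin m, k ≠ e → s'.arr 3 k = s.arr 3 k := by
  have e₁ := h.instr (a := .const 18 0) (by decide)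
  have h7 : (Instr.apply (.const 18 0) s).reg 7 = e := by simp [Instr.apply, he]
  have h18 : (Instr.apply (.const 18 0) s).reg 18 = 0 := by simp [Instr.apply]
  have hpen₁ : ∀ k : Fin m, (Instr.apply (.const 18 0) s).rarr 2 k = _ := hpen
  have h3 : (Instr.apply (.const 18 0) s).arr 3 = s.arr 3 := rfl
  refine (Runs.instr_seq
    (B := countTime n m + 2 + (2 + (m * (2 * countTime n m + 13) + 2 + 1 + 1))) ?_).of_le
    (by unfold decideTime; omega)
  generalize Instr.apply (.const 18 0) s = s₁ at e₁ h7 h18 hpen₁ h3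
  refine Runs.seq ((runs_cutProg e₁ (by decide) h7 h7).mono le_rfl ?_)
  rintro s₂ ⟨h₂, hf₂⟩
  have e₂ := e₁.frame (by decide) hf₂
  have h18₂ := (hf₂.reg 18 (by decide)).trans h18
  have h7₂ := (hf₂.reg 7 (by decide)).trans h7
  have hpen₂ : ∀ k : Fin m, s₂.rarr 2 k = _ := fun k =>
    (congrFun (hf₂.rarr 2 (by decide)) k).trans (hpen₁ k)
  have h3₂ := (hf₂.arr 3 (by decide)).trans h3
  have hbridge : Runs (.ite (.lt 10 6) (.instr (.const 18 1)) (.instr .skip)) s₂ 2 fun s' =>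
      s'.reg 18 = 1 ↔ cut G r (L.edge e) (L.edge e) ≠ 0 := by
    refine Runs.ite (B := 1) (fun hb => Runs.instr ?_) fun hb => Runs.instr ?_
    · simp only [Test.Holds, e₂.zero, h₂] at hb
      simp [Instr.apply, hb.ne']
    · simp only [Test.Holds, e₂.zero, h₂, not_lt, Nat.le_zero] at hb
      simp [Instr.apply, hb, h18₂]
  refine Runs.seq (hbridge.frame.mono le_rfl ?_)
  rintro s₃ ⟨h₃, hf₃⟩
  have e₃ := (e₂.frame (by decide) hf₃).instr (a := .rload 0 2 7) (by decide)
  have h7₃ : (Instr.apply (.rload 0 2 7) s₃).reg 7 = e := (hf₃.reg 7 (by decide)).trans h7₂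
  have hpen₃ : ∀ k : Fin m, (Instr.apply (.rload 0 2 7) s₃).rarr 2 k = _ := fun k =>
    (congrFun (hf₃.rarr 2 (by decide)) k).trans (hpen₂ k)
  have hr : (Instr.apply (.rload 0 2 7) s₃).rreg 0 = penalty G γ τ r (L.edge e) := by
    rw [← hpen₃ e, ← h7₃]
    simp [Instr.apply]
  have h3₃ : (Instr.apply (.rload 0 2 7) s₃).arr 3 = s.arr 3 := (hf₃.arr 3 (by decide)).trans h3₂
  have h18₃ : (Instr.apply (.rload 0 2 7) s₃).reg 18 = 1 ↔ _ := h₃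
  refine Runs.instr_seq ?_
  generalize Instr.apply (.rload 0 2 7) s₃ = s₄ at e₃ h7₃ hpen₃ hr h3₃ h18₃
  exact (runs_compareAllProg e₃ h7₃ hr hpen₃ h18₃).mono le_rfl fun _ hs => by rwa [h3₃] at hs

/-- The whole algorithm. -/
def cactusProg : Prog :=
  .seq (.instr (.const 9 1)) <| .seq (forLoop 7 1 9 penaltyProg) (forLoop 7 1 9 decideProg)

/-- A bound for the running time of `cactusProg`. -/
def cactusTime (n m : ℕ) : ℕ := m * (penaltyTime n m + 2) + 2 + (m * (decideTime n m + 2) + 2) + 1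

theorem runs_cactusProg {c : ℕ} (L : EdgeListing G m) (D : Decomposition G c)
    (γ τ : Sym2 (Fin n) → ℝ) (r : Fin n) :
    Runs cactusProg (inputState L D γ τ r) (cactusTime n m) fun s' =>
      ∀ e : Fin m, s'.arr 3 e = 1 ↔ L.edge e ∉ omitted G γ τ r L.index := by
  -- Only the constant 1 has to be created; register 10 is already 0 in the input.
  have h : Env L γ τ r (Instr.apply (.const 9 1) (inputState L D γ τ r)) := by
    constructor <;> simp [Instr.apply, inputState]
  refine Runs.instr_seq ?_
  generalize Instr.apply (.const 9 1) (inputState L D γ τ r) = s at h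
  refine Runs.seq ((Runs.forLoop (B := penaltyTime n m) (N := m)
    (fun k s' => ∀ e : Fin m, e < k → s'.rarr 2 e = penalty G γ τ r (L.edge e))
    (by decide) (by decide) (by decide) (by decide) (by decide) h.edges h.one
    (by simp) (fun k s' v h => h) ?_).frame.mono le_rfl ?_)
  · intro k s₁ hk hk' hf hi
    refine (runs_penaltyProg (e := ⟨k, hk⟩) (h.frame (by decide) hf) hk').mono le_rfl
      fun s₂ h₂ e he => ?_
    rw [h₂]
    rcases Nat.lt_succ_iff_lt_or_eq.1 he with he | he
    · rw [Function.update_of_ne he.ne, hi e he]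
    · obtain rfl : e = ⟨k, hk⟩ := Fin.ext he
      simp
  · rintro s₁ ⟨h₁, hf₁⟩
    have e₁ := h.frame (by decide) hf₁
    refine (Runs.forLoop (B := decideTime n m) (N := m)
      (fun k s' => ∀ e : Fin m, e < k →
        (s'.arr 3 e = 1 ↔ L.edge e ∉ omitted G γ τ r L.index))
      (by decide) (by decide) (by decide) (by decide) (by decide) e₁.edges e₁.one
      (by simp) (fun k s' v h => h) ?_).mono le_rfl fun s' h' e => h' e e.2
    intro k s₂ hk hk' hf hi
    refine (runs_decideProg (e := ⟨k, hk⟩) (e₁.frame (by decide) hf) hk'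
      fun j => (congrFun (hf.rarr 2 (by decide)) j).trans (h₁ j j.2)).mono le_rfl ?_
    rintro s₃ ⟨h₃, h₃'⟩ e he
    rcases Nat.lt_succ_iff_lt_or_eq.1 he with he | he
    · rw [h₃' e fun h => he.ne (congrArg Fin.val h), hi e he]
    · obtain rfl : e = ⟨k, hk⟩ := Fin.ext he
      exact h₃

/-! ### Polynomial time bound and output -/

theorem EdgeListing.le_mul_self (L : EdgeListing G m) : m ≤ n * n := by
  have hinj : Function.Injective fun k => (L.src k, L.tgt k) := by
    intro j k h
    rw [Prod.mk.injEq] at h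
    exact L.injective (by simp only [h.1, h.2])
  simpa using Fintype.card_le_of_injective _ hinj

theorem cactusTime_mono (n : ℕ) {m m' : ℕ} (h : m ≤ m') : cactusTime n m ≤ cactusTime n m' := by
  unfold cactusTime penaltyTime decideTime countTime
  gcongr

theorem exists_polynomial_cactusTime : ∃ p : Polynomial ℕ, ∀ n, p.eval n = cactusTime n (n * n) := by
  let x : Polynomial ℕ := Polynomial.X
  -- This is `countTime` with m = n², the largest value that the bound on the number of edges
  -- allows.
  let c : Polynomial ℕ := x * 3 + 2 + (x * (x * x * 14 + 4) + 3) + (x * 5 + 3)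
  refine ⟨x * x * (x * x * (c + 2 + (x * 3 + 3) + 2) + 6 + 2) + 2 +
    (x * x * (c + x * x * (2 * c + 13) + 9 + 2) + 2) + 1, fun n => ?_⟩
  simp [x, c, cactusTime, penaltyTime, decideTime, countTime]

theorem outputGraph_eq (L : EdgeListing G m) {X : Set (Sym2 (Fin n))}
    (h : ∀ e : Fin m, s.arr 3 e = 1 ↔ L.edge e ∉ X) : outputGraph L s = G.deleteEdges X := by
  rw [outputGraph, ← edgeSet_inj, edgeSet_fromEdgeSet, edgeSet_deleteEdges]
  ext x
  constructor
  · rintro ⟨⟨k, hk, rfl⟩, -⟩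
    exact ⟨L.edge_mem k, (h k).1 hk⟩
  · rintro ⟨hx, hX⟩
    refine ⟨?_, G.not_isDiag_of_mem_edgeSet hx⟩
    obtain ⟨k, rfl⟩ := L.exists_edge_eq hx
    exact ⟨k, (h k).2 hX, rfl⟩

end Algorithm

end CableTrench

theorem mainTheorem1 :
    ∃ (P : CableTrench.Prog) (p : Polynomial ℕ),
      ∀ (n m c : ℕ) (G : SimpleGraph (Fin n)), CableTrench.IsCactus G →
        ∀ (L : CableTrench.EdgeListing G m) (D : CableTrench.Decomposition G c)
          (γ τ : Sym2 (Fin n) → ℝ) (r : Fin n),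
          ∃ (t : ℕ) (s : CableTrench.State),
            t ≤ p.eval n ∧
            CableTrench.Exec P (CableTrench.inputState L D γ τ r) t s ∧
            CableTrench.IsCableTrenchTree G γ τ r (CableTrench.outputGraph L s) := by
  obtain ⟨p, hp⟩ := CableTrench.exists_polynomial_cactusTime
  refine ⟨CableTrench.cactusProg, p, fun n m c G hG L D γ τ r => ?_⟩
  obtain ⟨t, s, ht, hexec, hout⟩ := CableTrench.runs_cactusProg L D γ τ r
  refine ⟨t, s, ?_, hexec, ?_⟩
  · rw [hp]
    exact ht.trans (CableTrench.cactusTime_mono n L.le_mul_self)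
  · rw [CableTrench.outputGraph_eq L hout]
    exact hG.isCableTrenchTree_deleteEdges_omitted γ τ r L.injOn_index
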